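/- **Theorem (non-Abelian Stokes).** Let $G$ be a (finite-dimensional, real) Lie group with Lie algebra $\mathfrak g=T_1G$, let $\pi\colon P\to M$ be a smooth principal $G$-bundle with right action $P\times G\to P$, and let $A\in\Omega^1(P,\mathfrak g)$ be a connection on $P$, with curvature $F_A=dA+\tfrac12[A\wedge A]\in\Omega^2(P,\mathfrak g)$, i.e. $F_A(X,Y)=dA(X,Y)+[A(X),A(Y)]$, where $dA(X,Y)=X(A(Y))-Y(A(X))-A([X,Y])$. For a smooth path $\gamma\colon I=[0,1]\to M$ and $p\in P_{\gamma(0)}$ let $\mathrm{tra}(\gamma)(p)\in P_{\gamma(1)}$ be the end point of the horizontal lift of $\gamma$ starting at $p$. For $q,r$ in the same fibre of $P$ let $q:r\in G$ be the unique element with $r\cdot(q:r)=q$. For a continuous map $a\colon I\to\mathfrak g$ let $\mathcal P\exp\int_0^1 a(s)\,ds=g(1)$, where $g\colon I\to G$ is the solution of $g'(s)=a(s)\,g(s)$, $g(0)=1$ (here $\xi\,h\in T_hG$ is the right translate of $\xi\in\mathfrak g$ by $h$). Let $\Gamma\colon I^2\to M$, $\Gamma(s,t)=\Gamma_s(t)$,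 be a bigon, i.e. a smooth map with $\Gamma(s,0)=x$ and $\Gamma(s,1)=y$ for all $s\in I$, and let $p\in P_x$. Put $$\tilde\Gamma(s,t)=\mathrm{tra}(\Gamma_{s,t})(p),\qquad \Gamma_{s,t}(\tau)=\Gamma(s,t\tau).$$ Then for each $s\in I$ the path $\tilde\Gamma(s,\cdot)$ is the horizontal lift of $\Gamma_s$ starting at $p$, the map $\tilde\Gamma\colon I^2\to P$ is continuously differentiable, the function $t\mapsto\tilde\Gamma^*F_A(\partial s,\partial t)$ is integrable on $I$ for each $s\in I$, the path-ordered exponential below exists, and $$\mathrm{tra}(\Gamma_0)(p):\mathrm{tra}(\Gamma_1)(p)=\mathcal P\exp\int_0^1 ds\left[\int_0^1 dt\;\tilde\Gamma^*F_A(\partial s,\partial t)\right].$$ -/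

import Mathlib

open Set MeasureTheory
open scoped Manifold ContDiff

noncomputable section

namespace NAStokes

section LieGroupNotions

variable {EG : Type*} [NormedAddCommGroup EG] [NormedSpace ℝ EG]
  (G : Type*) [TopologicalSpace G] [ChartedSpace EG G] [Group G]

/-- The bracket of the Lie algebra `𝔤 = T₁G` (bracket of left invariant vector fields). The tangent
space `T₁G` is by definition a copy of the model space `EG`; throughout, `EG` with this bracket
plays the role of `𝔤`, because it carries the norm that is needed to integrate `𝔤`-valued
functions. -/
def bracket (ξ η : EG) : EG :=
  (⁅(show GroupLieAlgebra 𝓘(ℝ, EG) G from ξ), (show GroupLieAlgebra 𝓘(ℝ, EG) G from η)⁆ :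
    GroupLieAlgebra 𝓘(ℝ, EG) G)

variable {G}

/-- The adjoint action `Ad_g : 𝔤 → 𝔤`, the differential at `1` of `x ↦ g x g⁻¹`. -/
def Ad (g : G) (ξ : EG) : EG :=
  mfderiv 𝓘(ℝ, EG) 𝓘(ℝ, EG) (fun x : G => g * x * g⁻¹) 1 (show TangentSpace 𝓘(ℝ, EG) (1 : G) from ξ)

/-- The right translate `ξ · g ∈ T_g G` of `ξ ∈ 𝔤`, the image of `ξ` under the differential at `1`
of `x ↦ x g`. -/
def rightTranslate (ξ : EG) (g : G) : TangentSpace 𝓘(ℝ, EG) g :=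
  (mfderiv 𝓘(ℝ, EG) 𝓘(ℝ, EG) (fun x : G => x * g) 1
    (show TangentSpace 𝓘(ℝ, EG) (1 : G) from ξ) : EG)

/-- `g : [0,1] → G` solves `g'(s) = a(s) · g(s)`, `g(0) = 1`. -/
structure IsPathOrderedSolution (a : ℝ → EG) (g : ℝ → G) : Prop where
  init : g 0 = 1
  differentiable : ∀ s ∈ Icc (0 : ℝ) 1, MDifferentiableWithinAt 𝓘(ℝ, ℝ) 𝓘(ℝ, EG) g (Icc 0 1) s
  deriv : ∀ s ∈ Icc (0 : ℝ) 1,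
    mfderivWithin 𝓘(ℝ, ℝ) 𝓘(ℝ, EG) g (Icc 0 1) s (1 : ℝ) = rightTranslate (a s) (g s)

open Classical in
/-- The path ordered exponential `𝒫 exp ∫₀¹ a(s) ds = g(1)`, where `g` is the solution of
`g' = a g`, `g(0) = 1` (and `1` if there is no solution). -/
def pathOrderedExp (a : ℝ → EG) : G :=
  if h : ∃ g : ℝ → G, IsPathOrderedSolution a g then h.choose 1 else 1

end LieGroupNotions

section Bundles

variable (EM EP EG : Type*)
  [NormedAddCommGroup EM] [NormedSpace ℝ EM]
  [NormedAddCommGroup EP] [NormedSpace ℝ EP]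
  [NormedAddCommGroup EG] [NormedSpace ℝ EG]
  (M : Type*) [TopologicalSpace M] [ChartedSpace EM M]
  (P : Type*) [TopologicalSpace P] [ChartedSpace EP P]
  (G : Type*) [TopologicalSpace G] [ChartedSpace EG G] [Group G]

/-- A smooth principal `G`-bundle `P → M` with right action of `G`. -/
structure PrincipalBundle where
  /-- the projection -/
  proj : P → M
  /-- the right action `(q, g) ↦ q · g` -/
  act : P → G → P
  contMDiff_proj : ContMDiff 𝓘(ℝ, EP) 𝓘(ℝ, EM) ∞ proj
  contMDiff_act : ContMDiff (𝓘(ℝ, EP).prod 𝓘(ℝ, EG)) 𝓘(ℝ, EP) ∞ (fun z : P × G => act z.1 z.2)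
  act_one : ∀ q, act q 1 = q
  act_mul : ∀ q g h, act q (g * h) = act (act q g) h
  proj_act : ∀ q g, proj (act q g) = proj q
  /-- smooth `G`-equivariant local trivializations `π⁻¹(U) ≅ U × G` around each point -/
  locallyTrivial : ∀ x : M, ∃ (U : Set M) (e : OpenPartialHomeomorph P (M × G)),
    IsOpen U ∧ x ∈ U ∧ e.source = proj ⁻¹' U ∧ e.target = U ×ˢ univ ∧
    ContMDiffOn 𝓘(ℝ, EP) (𝓘(ℝ, EM).prod 𝓘(ℝ, EG)) ∞ e e.source ∧
    ContMDiffOn (𝓘(ℝ, EM).prod 𝓘(ℝ, EG)) 𝓘(ℝ, EP) ∞ e.symm e.target ∧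
    (∀ q ∈ e.source, (e q).1 = proj q) ∧
    ∀ q ∈ e.source, ∀ g, (e (act q g)).2 = (e q).2 * g

variable {EM EP EG M P G}

namespace PrincipalBundle

variable (B : PrincipalBundle EM EP EG M P G)

open Classical in
/-- The division `q : r`, the unique `g` with `r · g = q` for `q`, `r` in the same fibre. -/
def div (q r : P) : G := if h : ∃ g, B.act r g = q then h.choose else 1

theorem existsUnique_act_eq {q r : P} (h : B.proj q = B.proj r) : ∃! g, B.act r g = q := by
  obtain ⟨U, e, -, hx, hs, -, -, -, h1, h2⟩ := B.locallyTrivial (B.proj r)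
  have hr : r ∈ e.source := by rw [hs]; exact hx
  have hq : q ∈ e.source := by rw [hs, mem_preimage, h]; exact hx
  have ha : ∀ g, B.act r g ∈ e.source := fun g => by
    rw [hs, mem_preimage, B.proj_act]; exact hx
  refine ⟨(e r).2⁻¹ * (e q).2, ?_, ?_⟩
  · apply e.injOn (ha _) hq
    apply Prod.ext
    · rw [h1 _ (ha _), h1 _ hq, B.proj_act, h]
    · rw [h2 _ hr, mul_inv_cancel_left]
  · rintro g rfl
    rw [h2 _ hr, inv_mul_cancel_left]

theorem act_div {q r : P} (h : B.proj q = B.proj r) : B.act r (B.div q r) = q := by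
  have := (B.existsUnique_act_eq h).exists
  unfold div
  rw [dif_pos this]
  exact this.choose_spec

end PrincipalBundle

variable [IsManifold 𝓘(ℝ, EP) ∞ P]

/-- A connection on a principal bundle: a smooth `𝔤`-valued 1-form `A` on `P` which reproduces the
generators of the action and satisfies `R_g^* A = Ad_{g⁻¹} A`. -/
structure Connection (B : PrincipalBundle EM EP EG M P G) where
  /-- the connection 1-form -/
  form : ∀ q : P, TangentSpace 𝓘(ℝ, EP) q →L[ℝ] EG
  contMDiff_form : ContMDiff 𝓘(ℝ, EP).tangent 𝓘(ℝ, EG) ∞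
    (fun v : TangentBundle 𝓘(ℝ, EP) P => form v.1 v.2)
  vertical : ∀ (q : P) (ξ : EG),
    form (B.act q 1) (mfderiv 𝓘(ℝ, EG) 𝓘(ℝ, EP) (fun g : G => B.act q g) 1
      (show TangentSpace 𝓘(ℝ, EG) (1 : G) from ξ)) = ξ
  equivariant : ∀ (q : P) (g : G) (X : TangentSpace 𝓘(ℝ, EP) q),
    form (B.act q g) (mfderiv 𝓘(ℝ, EP) 𝓘(ℝ, EP) (fun r => B.act r g) q X) = Ad g⁻¹ (form q X)

/-- A vector valued 1-form on `P` read in the chart around `q`, as a 1-form on the model space. -/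
def chartForm (A : ∀ q : P, TangentSpace 𝓘(ℝ, EP) q →L[ℝ] EG) (q : P) (e : EP) : EP →L[ℝ] EG :=
  (A ((extChartAt 𝓘(ℝ, EP) q).symm e)).comp
    (mfderiv 𝓘(ℝ, EP) 𝓘(ℝ, EP) (extChartAt 𝓘(ℝ, EP) q).symm e)

/-- The exterior derivative `dA_q(X, Y)` of a vector valued 1-form on a manifold, computed in the
chart around `q` by `dω(x, y) = (D_x ω)(y) - (D_y ω)(x)`. -/
def extDerivForm (A : ∀ q : P, TangentSpace 𝓘(ℝ, EP) q →L[ℝ] EG) (q : P)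
    (X Y : TangentSpace 𝓘(ℝ, EP) q) : EG :=
  let φ := extChartAt 𝓘(ℝ, EP) q
  let D := fderiv ℝ (chartForm A q) (φ q)
  let x : EP := mfderiv 𝓘(ℝ, EP) 𝓘(ℝ, EP) φ q X
  let y : EP := mfderiv 𝓘(ℝ, EP) 𝓘(ℝ, EP) φ q Y
  D x y - D y x

namespace Connection

variable {B : PrincipalBundle EM EP EG M P G} (A : Connection B)

/-- The curvature `F_A = dA + ½ [A ∧ A]`, i.e. `F_A(X, Y) = dA(X, Y) + [A(X), A(Y)]`. -/
def curvature (q : P) (X Y : TangentSpace 𝓘(ℝ, EP) q) : EG :=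
  extDerivForm A.form q X Y + bracket G (A.form q X) (A.form q Y)

/-- `c : [0,1] → P` is a smooth horizontal lift, starting at `p`, of the path `γ : [0,1] → M`. -/
structure IsHorizontalLift (γ : ℝ → M) (p : P) (c : ℝ → P) : Prop where
  contMDiffOn : ContMDiffOn 𝓘(ℝ, ℝ) 𝓘(ℝ, EP) ∞ c (Icc 0 1)
  init : c 0 = p
  proj : ∀ t ∈ Icc (0 : ℝ) 1, B.proj (c t) = γ t
  horizontal : ∀ t ∈ Icc (0 : ℝ) 1,
    A.form (c t) (mfderivWithin 𝓘(ℝ, ℝ) 𝓘(ℝ, EP) c (Icc 0 1) t (1 : ℝ)) = 0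

open Classical in
/-- Parallel transport `tra(γ)(p)`: the end point of the horizontal lift of `γ` at `p`
(and `p` if there is no such lift). -/
def tra (γ : ℝ → M) (p : P) : P :=
  if h : ∃ c, A.IsHorizontalLift γ p c then h.choose 1 else p

/-- The surface `(s, t) ↦ tra(Γ_{s,t})(p)`, where `Γ_{s,t}(τ) = Γ(s, tτ)`. -/
def liftedSurface (Γ : ℝ × ℝ → M) (p : P) (z : ℝ × ℝ) : P :=
  A.tra (fun τ => Γ (z.1, z.2 * τ)) p

/-- The function `(f^* F_A)(∂s, ∂t)` on the unit square, for `f : [0,1]² → P`. -/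
def pullbackCurvature (f : ℝ × ℝ → P) (z : ℝ × ℝ) : EG :=
  A.curvature (f z)
    (mfderivWithin 𝓘(ℝ, ℝ × ℝ) 𝓘(ℝ, EP) f (Icc 0 1 ×ˢ Icc 0 1) z ((1, 0) : ℝ × ℝ))
    (mfderivWithin 𝓘(ℝ, ℝ × ℝ) 𝓘(ℝ, EP) f (Icc 0 1 ×ˢ Icc 0 1) z ((0, 1) : ℝ × ℝ))

/-- The function `s ↦ ∫₀¹ (f^* F_A)(∂s, ∂t) dt`, for `f : [0,1]² → P`. -/
def curvatureIntegral (f : ℝ × ℝ → P) (s : ℝ) : EG :=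
  ∫ t in (0 : ℝ)..1, A.pullbackCurvature f (s, t)

end Connection

variable (EM) in
/-- `Γ : [0,1]² → M`, `(s, t) ↦ Γ(s, t) = Γ_s(t)`, is a bigon: a smooth homotopy with fixed end
points `x`, `y` from the path `Γ_0` to the path `Γ_1`. -/
structure IsBigon (Γ : ℝ × ℝ → M) (x y : M) : Prop where
  contMDiffOn : ContMDiffOn 𝓘(ℝ, ℝ × ℝ) 𝓘(ℝ, EM) ∞ Γ (Icc 0 1 ×ˢ Icc 0 1)
  source : ∀ s ∈ Icc (0 : ℝ) 1, Γ (s, 0) = x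
  target : ∀ s ∈ Icc (0 : ℝ) 1, Γ (s, 1) = y

end Bundles

end NAStokes

end

/-! Write Λ for the lifted surface. Its t-curves are horizontal, so Λ^*A(∂t) = 0. The bracket term
of the curvature therefore vanishes, and because mixed partial derivatives commute, Λ^*F_A(∂s, ∂t) =
∂s(Λ^*A(∂t)) - ∂t(Λ^*A(∂s)) = -∂t h with h = Λ^*A(∂s) (`pullbackCurvature_eq`). The edge t = 0 is
the constant p, so h(s, 0) = 0 and the inner integral is a(s) = -h(s, 1), which is minus the
connection form along q(s) = Λ(s, 1).

All q(s) lie over y. For g(s) = q(0) : q(s) the product q · g is constant, and the product rule (q ·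
g)^*A = Ad_{g⁻¹} q^*A + g⁻¹ dg (`pullback_act`) turns this into g' = a g
(`isPathOrderedSolution_of_act_eq`); g(1) is the required ratio. The path ordered exponential is
read off an arbitrary solution, so uniqueness is needed too: two solutions make q · g and q · g'
horizontal, and horizontal curves over the same base curve differ by a constant
(`eqOn_of_isPathOrderedSolution`).

Most of the work is the smoothness of Λ, which is defined by a separate transport for every point
(s, t). In a trivialization and a chart of G, horizontality is an ordinary differential equation in
t with parameter s, and its solutions depend smoothly on both
(`contDiffOn_of_isParametricSolution`). The local surfaces are moved by s-dependent group elements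
to match initial values (`exists_init`), glued along t (`exists_glue`), and identified with Λ by
uniqueness of horizontal lifts (`liftedSurface_eq`). -/

namespace NAStokes

open Metric

/-! ### Grönwall estimates and linear differential equations -/

section ODE

open scoped NNReal Topology

/-- A Picard-Lindelöf solution stays in the ball on which the vector field is controlled. -/
theorem exists_solution_mem_closedBall {E : Type*} [NormedAddCommGroup E] [NormedSpace ℝ E]
    [CompleteSpace E] {f : ℝ → E → E} {c d : ℝ} {t₀ : Icc c d} {x₀ : E} {r L K : ℝ≥0}
    (hf : IsPicardLindelof f t₀ x₀ r 0 L K) :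
    ∃ α : ℝ → E, α t₀ = x₀ ∧ ∀ t ∈ Icc c d,
      HasDerivWithinAt α (f t (α t)) (Icc c d) t ∧ α t ∈ closedBall x₀ r := by
  have hx : x₀ ∈ closedBall x₀ ((0 : ℝ≥0) : ℝ) := mem_closedBall_self le_rfl
  obtain ⟨α, hα⟩ := ODE.FunSpace.exists_isFixedPt_next hf hx
  refine ⟨α.compProj, by rw [ODE.FunSpace.compProj_val, ← hα, ODE.FunSpace.next_apply₀],
    fun t ht ↦ ⟨?_, α.compProj_mem_closedBall hf.mul_max_le⟩⟩
  apply ODE.hasDerivWithinAt_picard_Icc t₀.2 hf.continuousOn_uncurry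
    α.continuous_compProj.continuousOn (fun _ _ ↦ α.compProj_mem_closedBall hf.mul_max_le)
    x₀ ht |>.congr_of_mem _ ht
  intro t' ht'
  nth_rw 1 [← hα]
  rw [ODE.FunSpace.compProj_of_mem ht', ODE.FunSpace.next_apply]

/-- The factor by which Grönwall's inequality amplifies the inhomogeneity on `[c, d]`. -/
noncomputable def gronwallFactor (C c d : ℝ) : ℝ := gronwallBound 0 C 1 (d - c)

theorem gronwallBound_zero_eq_mul (C ε x : ℝ) :
    gronwallBound 0 C ε x = ε * gronwallBound 0 C 1 x := by
  unfold gronwallBound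
  split_ifs <;> ring

theorem gronwallFactor_nonneg {C c d : ℝ} (hC : 0 ≤ C) (hcd : c ≤ d) :
    0 ≤ gronwallFactor C c d := by
  have h := gronwallBound_mono (δ := 0) (K := C) (ε := 1) le_rfl zero_le_one hC
    (sub_nonneg.2 hcd)
  rwa [gronwallBound_x0] at h

/-- A vanishing initial value makes the Grönwall bound linear in ε. With ε proportional to an
increment of the parameter, this yields Lipschitz and differentiability estimates in that parameter.
-/
theorem norm_le_gronwallFactor {E : Type*} [NormedAddCommGroup E] [NormedSpace ℝ E]
    {u u' : ℝ → E} {c d C ε : ℝ} (hC : 0 ≤ C) (hε : 0 ≤ ε)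
    (hu : ∀ t ∈ Icc c d, HasDerivWithinAt u (u' t) (Icc c d) t) (h0 : u c = 0)
    (hb : ∀ t ∈ Icc c d, ‖u' t‖ ≤ C * ‖u t‖ + ε) :
    ∀ t ∈ Icc c d, ‖u t‖ ≤ ε * gronwallFactor C c d := by
  intro t ht
  have h1 := norm_le_gronwallBound_of_norm_deriv_right_le (f := u) (f' := u') (δ := 0) (K := C)
    (ε := ε) (a := c) (b := d) (fun t ht ↦ (hu t ht).continuousWithinAt)
    (fun t ht ↦ ((hu t ⟨ht.1, ht.2.le⟩).mono_of_mem_nhdsWithin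
      (Icc_mem_nhdsGE_of_mem ht))) (by simp [h0])
    (fun t ht ↦ hb t ⟨ht.1, ht.2.le⟩) t ht
  refine h1.trans ?_
  rw [gronwallFactor, ← gronwallBound_zero_eq_mul]
  exact gronwallBound_mono le_rfl hε hC (by linarith [ht.2])

/-- Global existence for inhomogeneous linear equations. -/
theorem exists_linear_solution {E : Type*} [NormedAddCommGroup E] [NormedSpace ℝ E]
    [FiniteDimensional ℝ E] {c d : ℝ} (hcd : c ≤ d) {B : ℝ → E →L[ℝ] E} {b : ℝ → E}
    (hB : ContinuousOn B (Icc c d)) (hb : ContinuousOn b (Icc c d)) :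
    ∃ w : ℝ → E, w c = 0 ∧ ∀ t ∈ Icc c d, HasDerivWithinAt w (B t (w t) + b t) (Icc c d) t := by
  obtain ⟨M, hM⟩ := isCompact_Icc.exists_bound_of_continuousOn hB
  obtain ⟨N, hN⟩ := isCompact_Icc.exists_bound_of_continuousOn hb
  have hc : c ∈ Icc c d := ⟨le_rfl, hcd⟩
  have hM0 : 0 ≤ M := (norm_nonneg _).trans (hM c hc)
  have hN0 : 0 ≤ N := (norm_nonneg _).trans (hN c hc)
  set R := N * gronwallFactor M c d with hR
  have hR0 : 0 ≤ R := mul_nonneg hN0 (gronwallFactor_nonneg hM0 hcd)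
  -- The linear field is cut off outside a ball to make it bounded. Since `φ` does not increase
  -- norms, Grönwall bounds the solution of the modified equation by `R`, and there `χ` is 1, so the
  -- original equation holds.
  let χ : ContDiffBump (0 : E) := ⟨R + 1, R + 2, by linarith, by linarith⟩
  let φ : E → E := fun w ↦ χ w • w
  have hφs : HasCompactSupport φ := χ.hasCompactSupport.smul_right
  have hφc : ContDiff ℝ 1 φ := χ.contDiff.smul contDiff_id
  obtain ⟨C, hC⟩ := hφc.lipschitzWith_of_hasCompactSupport (𝕂 := ℝ) hφs one_ne_zero
  have hφn : ∀ w, ‖φ w‖ ≤ ‖w‖ := fun w ↦ by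
    rw [norm_smul, Real.norm_of_nonneg χ.nonneg]
    exact mul_le_of_le_one_left (norm_nonneg _) χ.le_one
  have hφb : ∀ w, ‖φ w‖ ≤ R + 2 := fun w ↦ by
    by_cases hw : ‖w‖ ≤ R + 2
    · exact (hφn w).trans hw
    · have : χ w = 0 := χ.zero_of_le_dist (by
        change R + 2 ≤ _
        simpa using (not_le.1 hw).le)
      simp only [φ, this, zero_smul, norm_zero]
      linarith
  -- `L` bounds the modified field everywhere, so with radius `a = L (d - c)` the Picard-Lindelöf
  -- time condition covers all of `[c, d]`.
  let L : ℝ≥0 := ⟨M * (R + 2) + N, by positivity⟩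
  let a : ℝ≥0 := ⟨(M * (R + 2) + N) * (d - c),
    mul_nonneg (by positivity) (sub_nonneg.2 hcd)⟩
  have hPL : IsPicardLindelof (fun t w ↦ B t (φ w) + b t) (⟨c, hc⟩ : Icc c d) (0 : E) a 0 L
      (M.toNNReal * C) := by
    refine ⟨fun t ht ↦ ?_, fun w _ ↦ ?_, fun t ht w _ ↦ ?_, ?_⟩
    · refine LipschitzOnWith.of_dist_le_mul fun x _ y _ ↦ ?_
      rw [dist_add_right, dist_eq_norm, ← map_sub]
      calc ‖B t (φ x - φ y)‖ ≤ M * ‖φ x - φ y‖ := (B t).le_of_opNorm_le (hM t ht) _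
        _ ≤ M * (C * dist x y) := by
          gcongr
          rw [← dist_eq_norm]
          exact hC.dist_le_mul x y
        _ = _ := by rw [NNReal.coe_mul, mul_assoc, Real.coe_toNNReal M hM0]
    · exact (hB.clm_apply continuousOn_const).add hb
    · calc ‖B t (φ w) + b t‖ ≤ ‖B t (φ w)‖ + ‖b t‖ := norm_add_le _ _
        _ ≤ M * (R + 2) + N := by
          gcongr
          · exact ((B t).le_of_opNorm_le (hM t ht) _).trans (by gcongr; exact hφb w)
          · exact hN t ht
    · rw [sub_self, max_eq_left (sub_nonneg.2 hcd), NNReal.coe_zero, sub_zero]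
      exact le_rfl
  obtain ⟨w, hw0, hw⟩ := hPL.exists_eq_forall_mem_Icc_hasDerivWithinAt₀
  have hwb : ∀ t ∈ Icc c d, ‖w t‖ ≤ R := by
    refine norm_le_gronwallFactor hM0 hN0 hw hw0 fun t ht ↦ ?_
    refine (norm_add_le _ _).trans (add_le_add ?_ (hN t ht))
    exact ((B t).le_of_opNorm_le (hM t ht) _).trans (by gcongr; exact hφn _)
  refine ⟨w, hw0, fun t ht ↦ ?_⟩
  have : φ (w t) = w t := by
    have : χ (w t) = 1 := χ.one_of_mem_closedBall (by
      rw [mem_closedBall_zero_iff]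
      exact (hwb t ht).trans (by change R ≤ R + 1; linarith))
    simp [φ, this]
  simpa only [this] using hw t ht

end ODE

/-! ### Smooth dependence of solutions on a parameter -/

section ParametricODE

open scoped NNReal Topology

universe u

/-- `y (s, ·)` solves `∂ₜ y = f ((s, t), y)` on `[c, d]` with constant initial value, for each
parameter `s ∈ [a, b]`, and takes values in `U`. -/
structure IsParametricSolution {E : Type*} [NormedAddCommGroup E] [NormedSpace ℝ E]
    (f : (ℝ × ℝ) × E → E) (a b c d : ℝ) (U : Set E) (y₀ : E) (y : ℝ × ℝ → E) : Prop where
  mapsTo : MapsTo y (Icc a b ×ˢ Icc c d) U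
  init : ∀ s ∈ Icc a b, y (s, c) = y₀
  hasDerivWithinAt : ∀ s ∈ Icc a b, ∀ t ∈ Icc c d,
    HasDerivWithinAt (fun t ↦ y (s, t)) (f ((s, t), y (s, t))) (Icc c d) t

theorem uniqueDiffOn_rectangle {a b c d : ℝ} (hab : a < b) (hcd : c < d) :
    UniqueDiffOn ℝ (Icc a b ×ˢ Icc c d) :=
  (uniqueDiffOn_Icc hab).prod (uniqueDiffOn_Icc hcd)

theorem exists_lipschitzOnWith_of_convex_compact {E F : Type*} [NormedAddCommGroup E]
    [NormedSpace ℝ E] [NormedAddCommGroup F] [NormedSpace ℝ F] {f : E → F} {D : Set E}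
    (hD : Convex ℝ D) (hDc : IsCompact D) (hDu : UniqueDiffOn ℝ D) (hf : ContDiffOn ℝ 1 f D) :
    ∃ C : ℝ≥0, LipschitzOnWith C f D := by
  obtain ⟨C, hC⟩ := hDc.exists_bound_of_continuousOn (hf.continuousOn_fderivWithin hDu le_rfl)
  refine ⟨C.toNNReal, hD.lipschitzOnWith_of_nnnorm_fderivWithin_le
    (hf.differentiableOn one_ne_zero) fun x hx ↦ ?_⟩
  rw [← NNReal.coe_le_coe, coe_nnnorm]
  exact (hC x hx).trans (Real.le_coe_toNNReal C)

/-- A uniform first order expansion of a `C¹` function on a compact convex set. -/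
theorem uniform_first_order {E F : Type*} [NormedAddCommGroup E]
    [NormedSpace ℝ E] [NormedAddCommGroup F] [NormedSpace ℝ F] {f : E → F} {D : Set E}
    (hD : Convex ℝ D) (hDc : IsCompact D) (hDu : UniqueDiffOn ℝ D) (hf : ContDiffOn ℝ 1 f D)
    {ε : ℝ} (hε : 0 < ε) :
    ∃ δ > 0, ∀ x ∈ D, ∀ y ∈ D, ‖y - x‖ < δ →
      ‖f y - f x - fderivWithin ℝ f D x (y - x)‖ ≤ ε * ‖y - x‖ := by
  have hc : ContinuousOn (fderivWithin ℝ f D) D := hf.continuousOn_fderivWithin hDu le_rfl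
  obtain ⟨δ, hδ, h⟩ := Metric.uniformContinuousOn_iff.1
    (hDc.uniformContinuousOn_of_continuous hc) ε hε
  refine ⟨δ, hδ, fun x hx y hy hxy ↦ ?_⟩
  refine Convex.norm_image_sub_le_of_norm_hasFDerivWithin_le' (s := D ∩ ball x δ)
    (f' := fderivWithin ℝ f D) (𝕜 := ℝ) (fun z hz ↦ ?_) (fun z hz ↦ ?_)
    (hD.inter (convex_ball x δ)) ⟨hx, mem_ball_self hδ⟩ ⟨hy, by rwa [mem_ball, dist_eq_norm]⟩
  · exact ((hf.differentiableOn one_ne_zero) z hz.1).hasFDerivWithinAt.mono inter_subset_left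
  · rw [← dist_eq_norm]
    exact (h z hz.1 x hx hz.2).le

namespace IsParametricSolution

variable {E : Type*} [NormedAddCommGroup E] [NormedSpace ℝ E]
  {f : (ℝ × ℝ) × E → E} {a b c d : ℝ} {U : Set E} {y₀ : E} {y : ℝ × ℝ → E}

theorem mem_domain (hy : IsParametricSolution f a b c d U y₀ y) {s t : ℝ} (hs : s ∈ Icc a b)
    (ht : t ∈ Icc c d) : ((s, t), y (s, t)) ∈ (Icc a b ×ˢ Icc c d) ×ˢ U :=
  ⟨⟨hs, ht⟩, hy.mapsTo ⟨hs, ht⟩⟩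

/-- The difference of the solutions for `s'` and `s` starts at 0, and its derivative is at most `C`
times its own norm plus `C |s' - s|`, so Grönwall applies. -/
theorem exists_lipschitz (hy : IsParametricSolution f a b c d U y₀ y)
    {C : ℝ≥0} (hf : LipschitzOnWith C f ((Icc a b ×ˢ Icc c d) ×ˢ U)) {s s' t : ℝ}
    (hs : s ∈ Icc a b) (hs' : s' ∈ Icc a b) (ht : t ∈ Icc c d) :
    ‖y (s', t) - y (s, t)‖ ≤ C * gronwallFactor C c d * |s' - s| := by
  have h := norm_le_gronwallFactor (u := fun t ↦ y (s', t) - y (s, t))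
    (u' := fun t ↦ f ((s', t), y (s', t)) - f ((s, t), y (s, t))) (C := C) (ε := C * |s' - s|)
    (c := c) (d := d) C.2 (by positivity)
    (fun t ht ↦ (hy.hasDerivWithinAt s' hs' t ht).sub (hy.hasDerivWithinAt s hs t ht))
    (by simp only [hy.init s hs, hy.init s' hs', sub_self]) (fun t ht ↦ ?_) t ht
  · exact h.trans_eq (by ring)
  · rw [← dist_eq_norm, ← mul_add]
    refine (hf.dist_le_mul _ (hy.mem_domain hs' ht) _ (hy.mem_domain hs ht)).trans ?_
    gcongr
    rw [Prod.dist_eq, Prod.dist_eq, dist_self, dist_eq_norm, dist_eq_norm, Real.norm_eq_abs]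
    refine max_le (max_le ?_ ?_) ?_ <;> 
      linarith [abs_nonneg (s' - s), norm_nonneg (y (s', t) - y (s, t))]

theorem continuousOn (hy : IsParametricSolution f a b c d U y₀ y)
    {C : ℝ≥0} (hf : LipschitzOnWith C f ((Icc a b ×ˢ Icc c d) ×ˢ U)) :
    ContinuousOn y (Icc a b ×ˢ Icc c d) := by
  refine continuousOn_prod_of_continuousOn_lipschitzOnWith y
    (C * gronwallFactor C c d).toNNReal (fun s hs t ht ↦
      (hy.hasDerivWithinAt s hs t ht).continuousWithinAt) fun t ht ↦ ?_
  refine LipschitzOnWith.of_dist_le_mul fun s hs s' hs' ↦ ?_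
  rw [dist_eq_norm, dist_eq_norm, Real.norm_eq_abs]
  refine (hy.exists_lipschitz hf hs' hs ht).trans ?_
  gcongr
  exact Real.le_coe_toNNReal _

/-- The derivative of the solution with respect to the parameter exists and solves the
linearized equation. -/
theorem exists_hasFDerivWithinAt [FiniteDimensional ℝ E]
    (hy : IsParametricSolution f a b c d U y₀ y) (hab : a < b) (hcd : c < d) (hU : Convex ℝ U)
    (hUc : IsCompact U) (hUi : (interior U).Nonempty)
    (hf : ContDiffOn ℝ 1 f ((Icc a b ×ˢ Icc c d) ×ˢ U)) {s : ℝ} (hs : s ∈ Icc a b) :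
    ∃ w : ℝ → E, w c = 0 ∧ ∀ t ∈ Icc c d,
      HasDerivWithinAt w (fderivWithin ℝ f ((Icc a b ×ˢ Icc c d) ×ˢ U) ((s, t), y (s, t))
        ((1, 0), w t)) (Icc c d) t ∧
      HasFDerivWithinAt y ((ContinuousLinearMap.fst ℝ ℝ ℝ).smulRight (w t) +
        (ContinuousLinearMap.snd ℝ ℝ ℝ).smulRight (f ((s, t), y (s, t))))
        (Icc a b ×ˢ Icc c d) (s, t) := by
  set D := (Icc a b ×ˢ Icc c d) ×ˢ U with hDdef
  have hD : Convex ℝ D := ((convex_Icc a b).prod (convex_Icc c d)).prod hU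
  have hDc : IsCompact D := (isCompact_Icc.prod isCompact_Icc).prod hUc
  have hDu : UniqueDiffOn ℝ D :=
    (uniqueDiffOn_rectangle hab hcd).prod (uniqueDiffOn_convex hU hUi)
  obtain ⟨C, hC⟩ := exists_lipschitzOnWith_of_convex_compact hD hDc hDu hf
  have hDf : ContinuousOn (fderivWithin ℝ f D) D := hf.continuousOn_fderivWithin hDu le_rfl
  have hyt : ContinuousOn (fun t ↦ ((s, t), y (s, t))) (Icc c d) :=
    (continuousOn_const.prodMk continuousOn_id).prodMk
      fun t ht ↦ (hy.hasDerivWithinAt s hs t ht).continuousWithinAt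
  have hT : ContinuousOn (fun t ↦ fderivWithin ℝ f D ((s, t), y (s, t))) (Icc c d) :=
    hDf.comp hyt fun t ht ↦ hy.mem_domain hs ht
  -- The candidate for ∂y/∂s solves the equation linearized along `y (s, ·)`. It starts at 0 because
  -- the initial value of `y` does not depend on `s`.
  obtain ⟨w, hw0, hw⟩ := exists_linear_solution hcd.le
    (B := fun t ↦ (fderivWithin ℝ f D ((s, t), y (s, t))).comp (ContinuousLinearMap.inr ℝ (ℝ × ℝ) E))
    (b := fun t ↦ fderivWithin ℝ f D ((s, t), y (s, t)) ((1, 0), 0))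
    (hT.clm_comp continuousOn_const) (hT.clm_apply continuousOn_const)
  have hw' : ∀ t ∈ Icc c d, HasDerivWithinAt w (fderivWithin ℝ f D ((s, t), y (s, t))
      ((1, 0), w t)) (Icc c d) t := fun t ht ↦ by
    convert hw t ht using 1
    rw [ContinuousLinearMap.comp_apply, ← map_add, ContinuousLinearMap.inr_apply, Prod.mk_add_mk,
      zero_add, add_zero]
  refine ⟨w, hw0, fun t ht ↦ ⟨hw' t ht, ?_⟩⟩
  obtain ⟨M, hM⟩ := hDc.exists_bound_of_continuousOn hDf
  have hM0 : 0 ≤ M := (norm_nonneg _).trans (hM _ (hy.mem_domain hs ht))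
  set κ := gronwallFactor M c d with hκ
  have hκ0 : 0 ≤ κ := gronwallFactor_nonneg hM0 hcd.le
  -- In the sup norm a change of parameter moves `((s, t), y (s, t))` by at most `l |s' - s|`; the 1
  -- accounts for the coordinate `s` itself.
  set l : ℝ := max 1 (C * gronwallFactor C c d) with hl
  have hl1 : 1 ≤ l := le_max_left _ _
  -- uniform differentiability in the parameter
  have key : ∀ ε > 0, ∃ δ > 0, ∀ s' ∈ Icc a b, |s' - s| < δ → ∀ t ∈ Icc c d,
      ‖y (s', t) - y (s, t) - (s' - s) • w t‖ ≤ ε * |s' - s| := by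
    intro ε hε
    -- The factor `l` pays for the size of the increment and `κ + 1` for the Grönwall amplification;
    -- adding 1 keeps the denominator positive.
    obtain ⟨δ, hδ, hδf⟩ := uniform_first_order hD hDc hDu hf
      (ε := ε / (l * (κ + 1))) (by positivity)
    refine ⟨δ / l, by positivity, fun s' hs' hss t ht ↦ ?_⟩
    have hinc : ∀ t ∈ Icc c d,
        ‖((s', t), y (s', t)) - ((s, t), y (s, t))‖ ≤ l * |s' - s| := fun t ht ↦ by
      simp only [Prod.mk_sub_mk, sub_self, Prod.norm_def, norm_zero, Real.norm_eq_abs]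
      refine max_le (max_le ?_ (by positivity)) ?_
      · exact le_mul_of_one_le_left (abs_nonneg _) hl1
      · refine (hy.exists_lipschitz hC hs hs' ht).trans ?_
        gcongr
        exact le_max_right _ _
    have hg := norm_le_gronwallFactor (u := fun t ↦ y (s', t) - y (s, t) - (s' - s) • w t)
      (u' := fun t ↦ f ((s', t), y (s', t)) - f ((s, t), y (s, t)) -
        (s' - s) • fderivWithin ℝ f D ((s, t), y (s, t)) ((1, 0), w t)) (C := M)
      (ε := ε / (κ + 1) * |s' - s|) (c := c) (d := d) hM0 (by positivity)
      (fun t ht ↦ ((hy.hasDerivWithinAt s' hs' t ht).sub (hy.hasDerivWithinAt s hs t ht)).sub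
        ((hw' t ht).const_smul _))
      (by simp only [hy.init s hs, hy.init s' hs', sub_self, hw0, smul_zero]) (fun t ht ↦ ?_) t ht
    · refine hg.trans ?_
      rw [← hκ]
      calc ε / (κ + 1) * |s' - s| * κ = ε * |s' - s| * (κ / (κ + 1)) := by ring
        _ ≤ ε * |s' - s| * 1 := by
          gcongr
          rw [div_le_one (by positivity)]
          linarith
        _ = _ := mul_one _
    · have h1 := hδf _ (hy.mem_domain hs ht) _ (hy.mem_domain hs' ht) ((hinc t ht).trans_lt (by
        rwa [lt_div_iff₀' (by positivity)] at hss))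
      set T := fderivWithin ℝ f D ((s, t), y (s, t)) with hTdef
      -- The derivative of the remainder splits into the error of the first order expansion, which
      -- is the inhomogeneity, and the linearized field applied to the remainder itself.
      have h2 : f ((s', t), y (s', t)) - f ((s, t), y (s, t)) - (s' - s) • T ((1, 0), w t) =
          (f ((s', t), y (s', t)) - f ((s, t), y (s, t)) -
            T (((s', t), y (s', t)) - ((s, t), y (s, t)))) +
          T ((0, 0), y (s', t) - y (s, t) - (s' - s) • w t) := by
        have : (((s', t), y (s', t)) - ((s, t), y (s, t)) : (ℝ × ℝ) × E) =
          (s' - s) • ((1, 0), w t) + ((0, 0), y (s', t) - y (s, t) - (s' - s) • w t) := by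
          ext <;> simp
        rw [this, map_add, map_smul]
        abel
      rw [h2]
      refine (norm_add_le _ _).trans ?_
      rw [add_comm]
      refine add_le_add ?_ (h1.trans ?_)
      · refine (T.le_of_opNorm_le (hM _ (hy.mem_domain hs ht)) _).trans (le_of_eq ?_)
        simp [Prod.norm_def]
      · calc ε / (l * (κ + 1)) * ‖((s', t), y (s', t)) - ((s, t), y (s, t))‖
            ≤ ε / (l * (κ + 1)) * (l * |s' - s|) := by gcongr; exact hinc t ht
          _ = _ := by field_simp
  refine HasFDerivWithinAt.of_isLittleO ?_
  rw [Asymptotics.isLittleO_iff]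
  intro ε hε
  obtain ⟨δ, hδ, hkey⟩ := key (ε / 3) (by positivity)
  have hwc : ContinuousWithinAt w (Icc c d) t := (hw' t ht).continuousWithinAt
  obtain ⟨δ₁, hδ₁, hw1⟩ := Metric.continuousWithinAt_iff.1 hwc (ε / 3) (by positivity)
  have hyd := (hy.hasDerivWithinAt s hs t ht)
  rw [hasDerivWithinAt_iff_isLittleO, Asymptotics.isLittleO_iff] at hyd
  obtain ⟨δ₂, hδ₂, hy2⟩ := Metric.mem_nhdsWithin_iff.1 (hyd (by positivity : 0 < ε / 3))
  refine Metric.mem_nhdsWithin_iff.2 ⟨min δ (min δ₁ δ₂), by positivity, ?_⟩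
  rintro ⟨s', t'⟩ ⟨hd, hs', ht'⟩
  rw [mem_ball, Prod.dist_eq, max_lt_iff, lt_min_iff, lt_min_iff, lt_min_iff, lt_min_iff] at hd
  have e1 := hkey s' hs' hd.1.1 t' ht'
  have e2 := (hw1 ht' hd.2.2.1).le
  have e3 : ‖y (s, t') - y (s, t) - (t' - t) • f ((s, t), y (s, t))‖ ≤ ε / 3 * ‖t' - t‖ :=
    hy2 ⟨hd.2.2.2, ht'⟩
  rw [dist_eq_norm] at e2
  have hns : |s' - s| ≤ ‖((s', t') : ℝ × ℝ) - (s, t)‖ := le_max_left _ _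
  have hnt : |t' - t| ≤ ‖((s', t') : ℝ × ℝ) - (s, t)‖ := le_max_right _ _
  change ‖y (s', t') - y (s, t) - ((s' - s) • w t + (t' - t) • f ((s, t), y (s, t)))‖ ≤
    ε * ‖((s' - s, t' - t) : ℝ × ℝ)‖
  rw [Prod.mk_sub_mk] at hns hnt
  -- The increment is taken first in `t` at fixed `s`, then in `s` at fixed `t'`; continuity of `w`
  -- replaces `w t'` by `w t`.
  have : y (s', t') - y (s, t) - ((s' - s) • w t + (t' - t) • f ((s, t), y (s, t))) =
      (y (s', t') - y (s, t') - (s' - s) • w t') + (s' - s) • (w t' - w t) +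
        (y (s, t') - y (s, t) - (t' - t) • f ((s, t), y (s, t))) := by
    rw [smul_sub]; abel
  rw [this]
  set n := ‖((s' - s, t' - t) : ℝ × ℝ)‖
  have e4 : ‖(s' - s) • (w t' - w t)‖ ≤ n * (ε / 3) := by
    rw [norm_smul, Real.norm_eq_abs]
    gcongr
  rw [Real.norm_eq_abs] at e3
  have e5 : ε / 3 * |s' - s| ≤ ε / 3 * n := by gcongr
  have e6 : ε / 3 * |t' - t| ≤ ε / 3 * n := by gcongr
  refine (norm_add₃_le).trans ?_
  linarith

end IsParametricSolution

/-- Solutions of smooth equations depend smoothly on time and on the parameter. -/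
theorem contDiffOn_nat_of_isParametricSolution (n : ℕ) :
    ∀ {E : Type u} [NormedAddCommGroup E] [NormedSpace ℝ E] [FiniteDimensional ℝ E]
      {f : (ℝ × ℝ) × E → E} {a b c d : ℝ} {U : Set E} {y₀ : E} {y : ℝ × ℝ → E}
      (_ : IsParametricSolution f a b c d U y₀ y) (_ : a < b) (_ : c < d) (_ : Convex ℝ U)
      (_ : IsCompact U) (_ : (interior U).Nonempty)
      (_ : ContDiffOn ℝ ∞ f ((Icc a b ×ˢ Icc c d) ×ˢ U)),
      ContDiffOn ℝ n y (Icc a b ×ˢ Icc c d) := by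
  induction n with
  | zero =>
    intro E _ _ _ f a b c d U y₀ y hy hab hcd hU hUc hUi hf
    obtain ⟨C, hC⟩ := exists_lipschitzOnWith_of_convex_compact
      (((convex_Icc a b).prod (convex_Icc c d)).prod hU)
      ((isCompact_Icc.prod isCompact_Icc).prod hUc)
      ((uniqueDiffOn_rectangle hab hcd).prod (uniqueDiffOn_convex hU hUi)) (hf.of_le (by simp))
    exact contDiffOn_zero.2 (hy.continuousOn hC)
  | succ n ih =>
    intro E _ _ _ f a b c d U y₀ y hy hab hcd hU hUc hUi hf
    set D := (Icc a b ×ˢ Icc c d) ×ˢ U with hDdef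
    have hDc : IsCompact D := (isCompact_Icc.prod isCompact_Icc).prod hUc
    have hR := uniqueDiffOn_rectangle hab hcd
    have hDu : UniqueDiffOn ℝ D := hR.prod (uniqueDiffOn_convex hU hUi)
    have hf1 : ContDiffOn ℝ 1 f D := hf.of_le (by simp)
    have hDf : ContDiffOn ℝ ∞ (fderivWithin ℝ f D) D := hf.fderivWithin hDu (by simp)
    obtain ⟨M, hM⟩ := hDc.exists_bound_of_continuousOn hDf.continuousOn
    have hM0 : 0 ≤ M := (norm_nonneg _).trans
      (hM _ (hy.mem_domain (left_mem_Icc.2 hab.le) (left_mem_Icc.2 hcd.le)))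
    choose! w hw0 hw using fun s (hs : s ∈ Icc a b) ↦
      hy.exists_hasFDerivWithinAt hab hcd hU hUc hUi hf1 hs
    -- An a priori bound on `w` makes the phase set of the enlarged system compact; the added 1
    -- gives the ball nonempty interior.
    set r := M * gronwallFactor M c d + 1 with hr
    have hr0 : 0 < r := add_pos_of_nonneg_of_pos
      (mul_nonneg hM0 (gronwallFactor_nonneg hM0 hcd.le)) one_pos
    have hwb : ∀ s ∈ Icc a b, ∀ t ∈ Icc c d, ‖w s t‖ ≤ r := fun s hs t ht ↦ by
      refine (norm_le_gronwallFactor hM0 hM0 (fun t ht ↦ (hw s hs t ht).1) (hw0 s hs)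
        (fun t ht ↦ ?_) t ht).trans (by linarith)
      refine ((fderivWithin ℝ f D _).le_of_opNorm_le (hM _ (hy.mem_domain hs ht)) _).trans ?_
      rw [← mul_add_one]
      gcongr
      simp only [Prod.norm_def, norm_one, norm_zero]
      refine max_le (max_le ?_ ?_) ?_ <;> linarith [norm_nonneg (w s t)]
    -- The pair (y, ∂y/∂s) solves a system of the same kind, with a field that is still smooth. The
    -- induction hypothesis makes both components of class Cⁿ, and the total derivative of `y` is
    -- built from `w` and `f (z, y z)`, so `y` is of class Cⁿ⁺¹.
    have haug : IsParametricSolution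
        (fun z : (ℝ × ℝ) × (E × E) ↦ (f (z.1, z.2.1), fderivWithin ℝ f D (z.1, z.2.1) ((1, 0), z.2.2)))
        a b c d (U ×ˢ closedBall 0 r) (y₀, 0) (fun z ↦ (y z, w z.1 z.2)) := by
      refine ⟨fun z hz ↦ ⟨hy.mapsTo hz, mem_closedBall_zero_iff.2 (hwb _ hz.1 _ hz.2)⟩,
        fun s hs ↦ by rw [hy.init s hs, hw0 s hs], fun s hs t ht ↦ ?_⟩
      exact (hy.hasDerivWithinAt s hs t ht).prodMk (hw s hs t ht).1
    have hp : ContDiffOn ℝ ∞ (fun z : (ℝ × ℝ) × (E × E) ↦ (z.1, z.2.1))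
        ((Icc a b ×ˢ Icc c d) ×ˢ (U ×ˢ closedBall 0 r)) := by fun_prop
    have hpm : MapsTo (fun z : (ℝ × ℝ) × (E × E) ↦ (z.1, z.2.1))
        ((Icc a b ×ˢ Icc c d) ×ˢ (U ×ˢ closedBall 0 r)) D := fun z hz ↦ ⟨hz.1, hz.2.1⟩
    have hyw := ih haug hab hcd (hU.prod (convex_closedBall 0 r))
      (hUc.prod (isCompact_closedBall 0 r))
      (by
        rw [interior_prod_eq]
        exact hUi.prod ⟨0, ball_subset_interior_closedBall (mem_ball_self hr0)⟩)
      ((hf.comp hp hpm).prodMk ((hDf.comp hp hpm).clm_apply (by fun_prop)))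
    have hyn : ContDiffOn ℝ n y (Icc a b ×ˢ Icc c d) := hyw.fst
    have hwn : ContDiffOn ℝ n (fun z : ℝ × ℝ ↦ w z.1 z.2) (Icc a b ×ˢ Icc c d) := hyw.snd
    have hder : ∀ z ∈ Icc a b ×ˢ Icc c d, HasFDerivWithinAt y
        ((ContinuousLinearMap.fst ℝ ℝ ℝ).smulRight (w z.1 z.2) +
        (ContinuousLinearMap.snd ℝ ℝ ℝ).smulRight (f (z, y z))) (Icc a b ×ˢ Icc c d) z :=
      fun z hz ↦ (hw z.1 hz.1 z.2 hz.2).2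
    have hfn : ContDiffOn ℝ n (fun z ↦ f (z, y z)) (Icc a b ×ˢ Icc c d) :=
      (hf.of_le (by exact_mod_cast le_top)).comp (contDiffOn_id.prodMk hyn)
        fun z hz ↦ ⟨hz, hy.mapsTo hz⟩
    refine contDiffOn_succ_of_fderivWithin (fun z hz ↦ (hder z hz).differentiableWithinAt)
      (fun h ↦ absurd h (WithTop.coe_ne_top (a := (n : ℕ∞)))) ?_
    refine ContDiffOn.congr (f := fun z : ℝ × ℝ ↦
      (ContinuousLinearMap.fst ℝ ℝ ℝ).smulRight (w z.1 z.2) +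
        (ContinuousLinearMap.snd ℝ ℝ ℝ).smulRight (f (z, y z))) ?_
      fun z hz ↦ (hder z hz).fderivWithin (hR z hz)
    exact (contDiffOn_const.smulRight hwn).add (contDiffOn_const.smulRight hfn)

theorem contDiffOn_of_isParametricSolution {E : Type u} [NormedAddCommGroup E] [NormedSpace ℝ E]
    [FiniteDimensional ℝ E] {f : (ℝ × ℝ) × E → E} {a b c d : ℝ} {U : Set E} {y₀ : E}
    {y : ℝ × ℝ → E} (hy : IsParametricSolution f a b c d U y₀ y) (hab : a < b) (hcd : c < d)
    (hU : Convex ℝ U) (hUc : IsCompact U) (hUi : (interior U).Nonempty)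
    (hf : ContDiffOn ℝ ∞ f ((Icc a b ×ˢ Icc c d) ×ˢ U)) :
    ContDiffOn ℝ ∞ y (Icc a b ×ˢ Icc c d) :=
  contDiffOn_infty.2 fun n ↦ contDiffOn_nat_of_isParametricSolution n hy hab hcd hU hUc hUi hf

/-- Short time existence of parametric solutions. -/
theorem exists_isParametricSolution {E : Type u} [NormedAddCommGroup E] [NormedSpace ℝ E]
    [FiniteDimensional ℝ E] {f : (ℝ × ℝ) × E → E} {a b c d r : ℝ} {y₀ : E}
    (hab : a < b) (hcd : c < d) (hr : 0 < r)
    (hf : ContDiffOn ℝ ∞ f ((Icc a b ×ˢ Icc c d) ×ˢ closedBall y₀ r)) :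
    ∃ ε > 0, ∀ c' d', c' ∈ Icc c d → d' ∈ Icc c d → c' < d' → d' - c' ≤ ε →
      ∃ y, IsParametricSolution f a b c' d' (closedBall y₀ r) y₀ y := by
  set D := (Icc a b ×ˢ Icc c d) ×ˢ closedBall y₀ r with hD
  have hDc : IsCompact D := (isCompact_Icc.prod isCompact_Icc).prod (isCompact_closedBall _ _)
  obtain ⟨C, hC⟩ := exists_lipschitzOnWith_of_convex_compact
      (((convex_Icc a b).prod (convex_Icc c d)).prod (convex_closedBall y₀ r)) hDc
      ((uniqueDiffOn_rectangle hab hcd).prod (uniqueDiffOn_convex (convex_closedBall y₀ r)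
        ⟨y₀, ball_subset_interior_closedBall (mem_ball_self hr)⟩)) (hf.of_le (by simp))
  obtain ⟨M, hM⟩ := hDc.exists_bound_of_continuousOn hf.continuousOn
  have hM0 : 0 ≤ M := (norm_nonneg _).trans (hM ((a, c), y₀)
    ⟨⟨left_mem_Icc.2 hab.le, left_mem_Icc.2 hcd.le⟩, mem_closedBall_self hr.le⟩)
  -- A field bounded by `M` moves the solution by at most `r` during this time; `M + 1` avoids
  -- division by zero.
  refine ⟨r / (M + 1), by positivity, fun c' d' hc' hd' hlt hle ↦ ?_⟩
  have hsub : Icc c' d' ⊆ Icc c d := Icc_subset_Icc hc'.1 hd'.2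
  have hPL : ∀ s ∈ Icc a b, IsPicardLindelof (fun t y ↦ f ((s, t), y))
      (⟨c', left_mem_Icc.2 hlt.le⟩ : Icc c' d') y₀ r.toNNReal 0 M.toNNReal C := by
    intro s hs
    have hrr : (r.toNNReal : ℝ) = r := Real.coe_toNNReal r hr.le
    refine ⟨fun t ht ↦ ?_, fun y hy ↦ ?_, fun t ht y hy ↦ ?_, ?_⟩
    · rw [hrr]
      refine LipschitzOnWith.of_dist_le_mul fun x hx y hy ↦ ?_
      refine (hC.dist_le_mul _ ⟨⟨hs, hsub ht⟩, hx⟩ _ ⟨⟨hs, hsub ht⟩, hy⟩).trans_eq ?_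
      simp [Prod.dist_eq]
    · rw [hrr] at hy
      exact hf.continuousOn.comp (by fun_prop) fun t ht ↦ ⟨⟨hs, hsub ht⟩, hy⟩
    · rw [hrr] at hy
      exact (hM _ ⟨⟨hs, hsub ht⟩, hy⟩).trans (Real.le_coe_toNNReal M)
    · rw [sub_self, max_eq_left (sub_nonneg.2 hlt.le), NNReal.coe_zero, sub_zero, hrr,
        Real.coe_toNNReal M hM0]
      calc M * (d' - c') ≤ (M + 1) * (r / (M + 1)) := by
            gcongr
            linarith
        _ = r := by field_simp
  choose! y hy0 hy using fun s hs ↦ exists_solution_mem_closedBall (hPL s hs)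
  refine ⟨fun z ↦ y z.1 z.2, fun z hz ↦ ?_, hy0, fun s hs t ht ↦ (hy s hs t ht).1⟩
  have := (hy z.1 hz.1 z.2 hz.2).2
  rwa [Real.coe_toNNReal r hr.le] at this

end ParametricODE

/-! ### Derivatives of maps of manifolds as linear maps of the model spaces -/

section ModelDerivative

variable (E E' E'' : Type*) [NormedAddCommGroup E] [NormedSpace ℝ E]
  [NormedAddCommGroup E'] [NormedSpace ℝ E'] [NormedAddCommGroup E''] [NormedSpace ℝ E'']
  {N N' N'' : Type*} [TopologicalSpace N] [ChartedSpace E N] [TopologicalSpace N']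
  [ChartedSpace E' N'] [TopologicalSpace N''] [ChartedSpace E'' N'']

/-- The derivative of a map of manifolds as a map of the model spaces. -/
noncomputable def modelDeriv (f : N → N') (x : N) : E →L[ℝ] E' :=
  mfderiv 𝓘(ℝ, E) 𝓘(ℝ, E') f x

/-- The derivative of a map of manifolds within a set as a map of the model spaces. -/
noncomputable def modelDerivWithin (f : N → N') (S : Set N) (x : N) : E →L[ℝ] E' :=
  mfderivWithin 𝓘(ℝ, E) 𝓘(ℝ, E') f S x

variable {E E' E''}

theorem modelDeriv_comp {f : N → N'} {g : N' → N''} {x : N} {y : N'}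
    (hg : MDifferentiableAt 𝓘(ℝ, E') 𝓘(ℝ, E'') g y)
    (hf : MDifferentiableAt 𝓘(ℝ, E) 𝓘(ℝ, E') f x) (hy : f x = y) (v : E) :
    modelDeriv E E'' (g ∘ f) x v = modelDeriv E' E'' g y (modelDeriv E E' f x v) := by
  subst hy
  unfold modelDeriv
  rw [mfderiv_comp x hg hf]
  rfl

theorem modelDerivWithin_comp {f : N → N'} {g : N' → N''} {S : Set N} {T : Set N'} {x : N} {y : N'}
    (hg : MDifferentiableWithinAt 𝓘(ℝ, E') 𝓘(ℝ, E'') g T y)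
    (hf : MDifferentiableWithinAt 𝓘(ℝ, E) 𝓘(ℝ, E') f S x) (hST : MapsTo f S T)
    (hS : UniqueMDiffWithinAt 𝓘(ℝ, E) S x) (hy : f x = y) (v : E) :
    modelDerivWithin E E'' (g ∘ f) S x v =
      modelDerivWithin E' E'' g T y (modelDerivWithin E E' f S x v) := by
  subst hy
  unfold modelDerivWithin
  rw [mfderivWithin_comp x hg hf hST hS]
  rfl

theorem modelDeriv_comp_modelDerivWithin {f : N → N'} {g : N' → N''} {S : Set N} {x : N} {y : N'}
    (hg : MDifferentiableAt 𝓘(ℝ, E') 𝓘(ℝ, E'') g y)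
    (hf : MDifferentiableWithinAt 𝓘(ℝ, E) 𝓘(ℝ, E') f S x)
    (hS : UniqueMDiffWithinAt 𝓘(ℝ, E) S x) (hy : f x = y) (v : E) :
    modelDerivWithin E E'' (g ∘ f) S x v =
      modelDeriv E' E'' g y (modelDerivWithin E E' f S x v) := by
  subst hy
  unfold modelDerivWithin modelDeriv
  rw [mfderiv_comp_mfderivWithin x hg hf hS]
  rfl

theorem modelDeriv_id (x : N) (v : E) : modelDeriv E E (id : N → N) x v = v := by
  unfold modelDeriv
  rw [mfderiv_id]
  rfl

theorem modelDerivWithin_const (q : N') (S : Set N) (x : N) (v : E) :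
    modelDerivWithin E E' (fun _ : N => q) S x v = 0 := by
  unfold modelDerivWithin
  rw [mfderivWithin_const]
  rfl

theorem modelDerivWithin_eq_fderivWithin (f : E → E') (S : Set E) (x v : E) :
    modelDerivWithin E E' f S x v = fderivWithin ℝ f S x v := by
  unfold modelDerivWithin
  rw [mfderivWithin_eq_fderivWithin]

theorem modelDerivWithin_congr {f g : N → N'} {S : Set N} {x : N} (h : EqOn f g S) (hx : x ∈ S)
    (v : E) : modelDerivWithin E E' f S x v = modelDerivWithin E E' g S x v := by
  unfold modelDerivWithin
  rw [mfderivWithin_congr_of_mem h hx]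

theorem modelDerivWithin_subset {f : N → N'} {S T : Set N} {x : N} (hST : S ⊆ T)
    (hS : UniqueMDiffWithinAt 𝓘(ℝ, E) S x)
    (hf : MDifferentiableWithinAt 𝓘(ℝ, E) 𝓘(ℝ, E') f T x) (v : E) :
    modelDerivWithin E E' f S x v = modelDerivWithin E E' f T x v := by
  unfold modelDerivWithin
  rw [mfderivWithin_subset hST hS hf]

end ModelDerivative

/-! ### Logarithmic derivatives on a Lie group -/

section LieGroupCalculus

variable {EG : Type*} [NormedAddCommGroup EG] [NormedSpace ℝ EG]
  {G : Type*} [TopologicalSpace G] [ChartedSpace EG G] [Group G]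

/-- The left logarithmic derivative: the tangent vector `Y` at `g` moved to the unit. -/
noncomputable def leftLog (g : G) (Y : EG) : EG :=
  modelDeriv EG EG (fun x : G => g⁻¹ * x) g Y

theorem leftLog_zero (g : G) : leftLog g (0 : EG) = 0 := map_zero _

theorem Ad_eq (g : G) (ξ : EG) : Ad g ξ = modelDeriv EG EG (fun x : G => g * x * g⁻¹) 1 ξ := rfl

theorem Ad_zero (g : G) : Ad g (0 : EG) = 0 := by rw [Ad_eq, map_zero]

theorem Ad_neg (g : G) (ξ : EG) : Ad g (-ξ) = -Ad g ξ := by rw [Ad_eq, Ad_eq, map_neg]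

variable [LieGroup 𝓘(ℝ, EG) ∞ G]

theorem mdifferentiable_mul_left (g : G) :
    MDifferentiable 𝓘(ℝ, EG) 𝓘(ℝ, EG) (fun x : G => g * x) :=
  (contMDiff_mul_left (I := 𝓘(ℝ, EG)) (n := ∞)).mdifferentiable (by simp)

theorem mdifferentiable_mul_right (g : G) :
    MDifferentiable 𝓘(ℝ, EG) 𝓘(ℝ, EG) (fun x : G => x * g) :=
  (contMDiff_mul_right (I := 𝓘(ℝ, EG)) (n := ∞)).mdifferentiable (by simp)

theorem modelDeriv_mul_left_leftLog (g : G) (Y : EG) :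
    modelDeriv EG EG (fun x : G => g * x) 1 (leftLog g Y) = Y := by
  have h := modelDeriv_comp (f := fun x : G => g⁻¹ * x) (g := fun x : G => g * x)
    (mdifferentiable_mul_left g 1) (mdifferentiable_mul_left g⁻¹ g) (inv_mul_cancel g) Y
  have h2 : (fun x : G => g * x) ∘ (fun x : G => g⁻¹ * x) = id := by ext x; simp
  rw [h2, modelDeriv_id] at h
  exact h.symm

theorem leftLog_injective (g : G) : Function.Injective (leftLog (EG := EG) g) :=
  Function.LeftInverse.injective (modelDeriv_mul_left_leftLog g)

/-- The map `x ↦ g⁻¹ (x g)` is conjugation by `g⁻¹`. This translates the equation `g' = a g`,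
written with right translates, into the left logarithmic derivative of the product rule. -/
theorem leftLog_rightTranslate (g : G) (ξ : EG) : 
    leftLog (EG := EG) g (rightTranslate ξ g) = Ad g⁻¹ ξ := by
  have h := modelDeriv_comp (f := fun x : G => x * g) (g := fun x : G => g⁻¹ * x)
    (mdifferentiable_mul_left g⁻¹ g) (mdifferentiable_mul_right g 1) (one_mul g) ξ
  have h2 : (fun x : G => g⁻¹ * x) ∘ (fun x : G => x * g) = fun x : G => g⁻¹ * x * g⁻¹⁻¹ := by
    ext x; simp [mul_assoc]
  rw [h2] at h
  exact h.symm

end LieGroupCalculus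

/-! ### Curves with vanishing derivative -/

section ConstantOfDeriv

open scoped Topology

/-- A differentiable curve in a manifold with vanishing derivative is constant. -/
theorem eq_of_modelDerivWithin_eq_zero {E : Type*} [NormedAddCommGroup E] [NormedSpace ℝ E]
    {N : Type*} [TopologicalSpace N] [ChartedSpace E N] [IsManifold 𝓘(ℝ, E) ∞ N]
    {a b : ℝ} {k : ℝ → N}
    (hk : ∀ t ∈ Icc a b, MDifferentiableWithinAt 𝓘(ℝ, ℝ) 𝓘(ℝ, E) k (Icc a b) t)
    (h0 : ∀ t ∈ Icc a b, modelDerivWithin ℝ E k (Icc a b) t 1 = 0)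
    {t t' : ℝ} (ht : t ∈ Icc a b) (ht' : t' ∈ Icc a b) : k t = k t' := by
  -- In a chart the mean value inequality with constant 0 gives local constancy; connectedness of
  -- the interval then makes it global.
  have hloc : ∀ t ∈ Icc a b, ∀ᶠ t' in 𝓝[Icc a b] t, k t' = k t := by
    intro t ht
    have hcont : ContinuousWithinAt k (Icc a b) t := (hk t ht).continuousWithinAt
    have hsrc : k ⁻¹' (chartAt E (k t)).source ∈ 𝓝[Icc a b] t :=
      hcont ((chartAt E (k t)).open_source.mem_nhds (mem_chart_source E (k t)))
    obtain ⟨ε, hε, hsub⟩ := Metric.mem_nhdsWithin_iff.1 hsrc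
    set K := Icc a b ∩ ball t ε with hK
    have hKs : ∀ τ ∈ K, k τ ∈ (chartAt E (k t)).source := fun τ hτ => hsub ⟨hτ.2, hτ.1⟩
    let φ := extChartAt 𝓘(ℝ, E) (k t)
    have hd : ∀ τ ∈ K, HasFDerivWithinAt (φ ∘ k) (0 : ℝ →L[ℝ] E) K τ := by
      intro τ hτ
      have h1 := (hk τ hτ.1).hasMFDerivWithinAt
      have hz : mfderivWithin 𝓘(ℝ, ℝ) 𝓘(ℝ, E) k (Icc a b) τ = 0 := by
        apply ContinuousLinearMap.ext_ring
        exact h0 τ hτ.1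
      rw [hz] at h1
      have h2 : HasMFDerivAt 𝓘(ℝ, E) 𝓘(ℝ, E) φ (k τ) (mfderiv 𝓘(ℝ, E) 𝓘(ℝ, E) φ (k τ)) :=
        (mdifferentiableAt_extChartAt (hKs τ hτ)).hasMFDerivAt
      have h3 := h2.comp_hasMFDerivWithinAt τ h1
      have h4 := (h3.mono (inter_subset_left : K ⊆ Icc a b)).hasFDerivWithinAt
      have hc : (mfderiv 𝓘(ℝ, E) 𝓘(ℝ, E) φ (k τ)).comp
          (0 : TangentSpace 𝓘(ℝ, ℝ) τ →L[ℝ] TangentSpace 𝓘(ℝ, E) (k τ)) = 0 :=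
        ContinuousLinearMap.comp_zero _
      rw [hc] at h4
      exact h4
    have hKc : Convex ℝ K := (convex_Icc a b).inter (convex_ball t ε)
    refine Metric.mem_nhdsWithin_iff.2 ⟨ε, hε, fun τ hτ => ?_⟩
    have hτK : τ ∈ K := ⟨hτ.2, hτ.1⟩
    have htK : t ∈ K := ⟨ht, mem_ball_self hε⟩
    have hle := hKc.norm_image_sub_le_of_norm_hasFDerivWithin_le (𝕜 := ℝ) (C := 0) hd
      (fun _ _ => by simp) htK hτK
    rw [zero_mul, norm_le_zero_iff, sub_eq_zero] at hle
    exact φ.injOn (by simpa [φ] using hKs τ hτK) (by simp [φ]) hle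
  refine isPreconnected_Icc.induction₂ (fun t t' => k t = k t') (fun t ht => ?_)
    (fun x y z _ _ _ h h' => h.trans h') (fun x y _ _ h => h.symm) ht ht'
  filter_upwards [hloc t ht] with τ hτ using hτ.symm

end ConstantOfDeriv

/-! ### Pull-backs of the connection form and uniqueness of horizontal curves -/

section PullbackForm

open scoped Topology

variable {EM EP EG : Type*}
  [NormedAddCommGroup EM] [NormedSpace ℝ EM]
  [NormedAddCommGroup EP] [NormedSpace ℝ EP]
  [NormedAddCommGroup EG] [NormedSpace ℝ EG]
  {M : Type*} [TopologicalSpace M] [ChartedSpace EM M]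
  {P : Type*} [TopologicalSpace P] [ChartedSpace EP P]
  {G : Type*} [TopologicalSpace G] [ChartedSpace EG G] [Group G]
  {X Y : Type*} [NormedAddCommGroup X] [NormedSpace ℝ X] [NormedAddCommGroup Y] [NormedSpace ℝ Y]

namespace PrincipalBundle

variable (B : PrincipalBundle EM EP EG M P G)

theorem div_act (q : P) (g : G) : B.div (B.act q g) q = g :=
  (B.existsUnique_act_eq (B.proj_act q g)).unique (B.act_div (B.proj_act q g)) rfl

theorem div_self (q : P) : B.div q q = 1 := by
  conv_lhs => rw [← B.act_one q]
  conv_lhs => arg 3; rw [B.act_one q]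
  exact B.div_act q 1

theorem mdifferentiableAt_act (q : P) (g : G) :
    MDifferentiableAt (𝓘(ℝ, EP).prod 𝓘(ℝ, EG)) 𝓘(ℝ, EP) (fun z : P × G => B.act z.1 z.2) (q, g) :=
  B.contMDiff_act.mdifferentiable (by simp) _

theorem mdifferentiable_act_right (q : P) :
    MDifferentiable 𝓘(ℝ, EG) 𝓘(ℝ, EP) (fun g : G => B.act q g) := fun g =>
  (B.mdifferentiableAt_act q g).comp g (mdifferentiableAt_const.prodMk mdifferentiableAt_id)

theorem mdifferentiableWithinAt_act {c : X → P} {k : X → G} {S : Set X} {z : X}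
    (hc : MDifferentiableWithinAt 𝓘(ℝ, X) 𝓘(ℝ, EP) c S z)
    (hk : MDifferentiableWithinAt 𝓘(ℝ, X) 𝓘(ℝ, EG) k S z) :
    MDifferentiableWithinAt 𝓘(ℝ, X) 𝓘(ℝ, EP) (fun z => B.act (c z) (k z)) S z :=
  (B.mdifferentiableAt_act (c z) (k z)).comp_mdifferentiableWithinAt z (hc.prodMk hk)

theorem contMDiffOn_act {c : X → P} {k : X → G} {S : Set X}
    (hc : ContMDiffOn 𝓘(ℝ, X) 𝓘(ℝ, EP) ∞ c S) (hk : ContMDiffOn 𝓘(ℝ, X) 𝓘(ℝ, EG) ∞ k S) :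
    ContMDiffOn 𝓘(ℝ, X) 𝓘(ℝ, EP) ∞ (fun z => B.act (c z) (k z)) S :=
  B.contMDiff_act.comp_contMDiffOn (hc.prodMk hk)

/-- The derivative of a product `c · k`. -/
theorem modelDerivWithin_act {c : X → P} {k : X → G} {S : Set X} {z : X}
    (hc : MDifferentiableWithinAt 𝓘(ℝ, X) 𝓘(ℝ, EP) c S z)
    (hk : MDifferentiableWithinAt 𝓘(ℝ, X) 𝓘(ℝ, EG) k S z) (hS : UniqueDiffWithinAt ℝ S z) (v : X) :
    modelDerivWithin X EP (fun z => B.act (c z) (k z)) S z v =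
      modelDeriv EP EP (fun q => B.act q (k z)) (c z) (modelDerivWithin X EP c S z v) +
      modelDeriv EG EP (fun g => B.act (c z) g) (k z) (modelDerivWithin X EG k S z v) := by
  have h := mfderiv_comp_mfderivWithin z (I := 𝓘(ℝ, X)) (I' := 𝓘(ℝ, EP).prod 𝓘(ℝ, EG))
    (I'' := 𝓘(ℝ, EP)) (g := fun z : P × G => B.act z.1 z.2) (f := fun z => (c z, k z)) (s := S)
    (B.mdifferentiableAt_act (c z) (k z)) (hc.prodMk hk) hS.uniqueMDiffWithinAt
  rw [mfderivWithin_prodMk hc hk hS.uniqueMDiffWithinAt] at h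
  have h2 := DFunLike.congr_fun h v
  refine h2.trans ?_
  exact mfderiv_prod_eq_add_apply (B.mdifferentiableAt_act (c z) (k z))

/-- Division is smooth. -/
theorem contMDiffOn_div [LieGroup 𝓘(ℝ, EG) ∞ G] {c c' : X → P} {S : Set X}
    (hc : ContMDiffOn 𝓘(ℝ, X) 𝓘(ℝ, EP) ∞ c S) (hc' : ContMDiffOn 𝓘(ℝ, X) 𝓘(ℝ, EP) ∞ c' S)
    (h : ∀ z ∈ S, B.proj (c' z) = B.proj (c z)) :
    ContMDiffOn 𝓘(ℝ, X) 𝓘(ℝ, EG) ∞ (fun z => B.div (c' z) (c z)) S := by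
  intro z hz
  obtain ⟨U, e, hU, hx, hs, -, he, -, h1, h2⟩ := B.locallyTrivial (B.proj (c z))
  have hsrc : ∀ q, q ∈ e.source ↔ B.proj q ∈ U := fun q => by rw [hs]; rfl
  have hmem : c z ∈ e.source := (hsrc _).2 hx
  have hmem' : c' z ∈ e.source := (hsrc _).2 (by rw [h z hz]; exact hx)
  have key : ∀ c : X → P, ContMDiffOn 𝓘(ℝ, X) 𝓘(ℝ, EP) ∞ c S → c z ∈ e.source →
      ContMDiffWithinAt 𝓘(ℝ, X) 𝓘(ℝ, EG) ∞ (fun z => (e (c z)).2) S z := fun c hc hm =>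
    ((he.contMDiffAt (e.open_source.mem_nhds hm)).comp_contMDiffWithinAt z (hc z hz)).snd
  have hev : ∀ᶠ z' in 𝓝[S] z, c z' ∈ e.source :=
    (hc z hz).continuousWithinAt (e.open_source.mem_nhds hmem)
  -- In an equivariant trivialization, division of points becomes division of their G-components,
  -- which is visibly smooth.
  have heq : ∀ z' ∈ S, c z' ∈ e.source →
      B.div (c' z') (c z') = (e (c z')).2⁻¹ * (e (c' z')).2 := by
    intro z' hz' hm
    conv_rhs => rw [← B.act_div (h z' hz'), h2 _ hm, inv_mul_cancel_left]
  refine (((key c hc hmem).inv).mul (key c' hc' hmem')).congr_of_eventuallyEq ?_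
    (heq z hz hmem)
  filter_upwards [hev, self_mem_nhdsWithin] with z' hm hz' using heq z' hz' hm

end PrincipalBundle

variable [IsManifold 𝓘(ℝ, EP) ∞ P] {B : PrincipalBundle EM EP EG M P G} (A : Connection B)

namespace Connection

/-- The connection form as a map on the model space. -/
noncomputable def modelForm (q : P) : EP →L[ℝ] EG := A.form q

/-- The pull-back `f^* A` of the connection form along a map defined on a subset of a normed
space. -/
noncomputable def pullback (f : X → P) (S : Set X) (z v : X) : EG :=
  A.modelForm (f z) (modelDerivWithin X EP f S z v)

theorem pullback_add (f : X → P) (S : Set X) (z v w : X) :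
    A.pullback f S z (v + w) = A.pullback f S z v + A.pullback f S z w := by
  simp only [pullback, map_add]

theorem pullback_smul (f : X → P) (S : Set X) (z v : X) (r : ℝ) :
    A.pullback f S z (r • v) = r • A.pullback f S z v := by
  simp only [pullback, map_smul]

theorem pullback_const (q : P) (S : Set X) (z v : X) : A.pullback (fun _ => q) S z v = 0 := by
  rw [pullback, modelDerivWithin_const, map_zero]

theorem pullback_congr {f g : X → P} {S : Set X} {z : X} (h : EqOn f g S) (hz : z ∈ S) (v : X) :
    A.pullback f S z v = A.pullback g S z v := by
  rw [pullback, pullback, modelDerivWithin_congr h hz, h hz]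

theorem pullback_subset {f : X → P} {S T : Set X} {z : X} (hST : S ⊆ T)
    (hS : UniqueDiffWithinAt ℝ S z) (hf : MDifferentiableWithinAt 𝓘(ℝ, X) 𝓘(ℝ, EP) f T z) (v : X) :
    A.pullback f S z v = A.pullback f T z v := by
  rw [pullback, pullback, modelDerivWithin_subset hST hS.uniqueMDiffWithinAt hf]

theorem pullback_comp {f : X → P} {g : Y → X} {S : Set X} {T : Set Y} {z : Y}
    (hf : MDifferentiableWithinAt 𝓘(ℝ, X) 𝓘(ℝ, EP) f S (g z)) (hg : DifferentiableWithinAt ℝ g T z)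
    (hTS : MapsTo g T S) (hT : UniqueDiffWithinAt ℝ T z) (v : Y) :
    A.pullback (f ∘ g) T z v = A.pullback f S (g z) (fderivWithin ℝ g T z v) := by
  rw [pullback, pullback, modelDerivWithin_comp hf hg.mdifferentiableWithinAt hTS
    hT.uniqueMDiffWithinAt rfl, modelDerivWithin_eq_fderivWithin]
  rfl

/-- The function factors as the constant section `v`, the tangent map of `f`, and `A` viewed as a
smooth function on the tangent bundle of `P`. -/
theorem contDiffOn_pullback {f : X → P} {S : Set X} (hf : ContMDiffOn 𝓘(ℝ, X) 𝓘(ℝ, EP) ∞ f S)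
    (hS : UniqueDiffOn ℝ S) (v : X) : ContDiffOn ℝ ∞ (fun z => A.pullback f S z v) S := by
  have h1 : ContMDiffOn 𝓘(ℝ, X).tangent 𝓘(ℝ, EP).tangent ∞
      (tangentMapWithin 𝓘(ℝ, X) 𝓘(ℝ, EP) f S) _ :=
    hf.contMDiffOn_tangentMapWithin (m := ∞) (by simp) hS.uniqueMDiffOn
  have h2 : ContMDiffOn 𝓘(ℝ, X) 𝓘(ℝ, X).tangent ∞
      (fun z => (⟨z, v⟩ : TangentBundle 𝓘(ℝ, X) X)) S :=
    contMDiffOn_vectorSpace_iff_contDiffOn.2 contDiffOn_const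
  have h3 := A.contMDiff_form.comp_contMDiffOn (h1.comp h2 fun z hz => hz)
  exact h3.contDiffOn

theorem modelForm_act_left (q : P) (g : G) (v : EP) :
    A.modelForm (B.act q g) (modelDeriv EP EP (fun r => B.act r g) q v) =
      Ad g⁻¹ (A.modelForm q v) :=
  A.equivariant q g v

theorem modelForm_vertical (q : P) (ξ : EG) :
    A.modelForm q (modelDeriv EG EP (fun g => B.act q g) 1 ξ) = ξ := by
  have h := A.vertical q ξ
  change A.modelForm (B.act q 1) (modelDeriv EG EP (fun g => B.act q g) 1 ξ) = ξ at h
  rwa [B.act_one] at h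

variable [LieGroup 𝓘(ℝ, EG) ∞ G]

/-- Writing `q · x = (q · g) · (g⁻¹ x)` moves the derivative at `g` to the unit, where the
connection reproduces the generators at the point `q · g`. -/
theorem modelForm_act_right (q : P) (g : G) (Y : EG) :
    A.modelForm (B.act q g) (modelDeriv EG EP (fun g => B.act q g) g Y) = leftLog g Y := by
  have h := modelDeriv_comp (f := fun x : G => g⁻¹ * x) (g := fun x : G => B.act (B.act q g) x)
    (B.mdifferentiable_act_right _ 1) (mdifferentiable_mul_left g⁻¹ g) (inv_mul_cancel g) Y
  have h2 : (fun x : G => B.act (B.act q g) x) ∘ (fun x : G => g⁻¹ * x) = fun x => B.act q x := by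
    ext x
    simp only [Function.comp_apply, ← B.act_mul, mul_inv_cancel_left]
  rw [h2] at h
  rw [h, A.modelForm_vertical]
  rfl

/-- The product rule `(c · k)^* A = Ad_{k⁻¹} c^* A + k⁻¹ dk`. -/
theorem pullback_act {c : X → P} {k : X → G} {S : Set X} {z : X}
    (hc : MDifferentiableWithinAt 𝓘(ℝ, X) 𝓘(ℝ, EP) c S z)
    (hk : MDifferentiableWithinAt 𝓘(ℝ, X) 𝓘(ℝ, EG) k S z) (hS : UniqueDiffWithinAt ℝ S z) (v : X) :
    A.pullback (fun z => B.act (c z) (k z)) S z v =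
      Ad (k z)⁻¹ (A.pullback c S z v) + leftLog (k z) (modelDerivWithin X EG k S z v) := by
  rw [pullback, B.modelDerivWithin_act hc hk hS, map_add, A.modelForm_act_left,
    A.modelForm_act_right]
  rfl

/-- If `c` and `c · k` are both horizontal then `k` is constant. -/
theorem eq_of_pullback_eq_zero {a b : ℝ} (hab : a < b) {c : ℝ → P} {k : ℝ → G}
    (hc : ∀ t ∈ Icc a b, MDifferentiableWithinAt 𝓘(ℝ, ℝ) 𝓘(ℝ, EP) c (Icc a b) t)
    (hk : ∀ t ∈ Icc a b, MDifferentiableWithinAt 𝓘(ℝ, ℝ) 𝓘(ℝ, EG) k (Icc a b) t)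
    (h0 : ∀ t ∈ Icc a b, A.pullback c (Icc a b) t 1 = 0)
    (h1 : ∀ t ∈ Icc a b, A.pullback (fun t => B.act (c t) (k t)) (Icc a b) t 1 = 0)
    {t t' : ℝ} (ht : t ∈ Icc a b) (ht' : t' ∈ Icc a b) : k t = k t' := by
  have : IsManifold 𝓘(ℝ, EG) ∞ G := LieGroup.toContMDiffMul.toIsManifold
  refine eq_of_modelDerivWithin_eq_zero hk (fun t ht => ?_) ht ht'
  have h := h1 t ht
  rw [A.pullback_act (hc t ht) (hk t ht) (uniqueDiffOn_Icc hab t ht), h0 t ht, Ad_zero,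
    zero_add] at h
  exact leftLog_injective (k t) (h.trans (leftLog_zero (k t)).symm)

/-- Smooth horizontal curves over the same curve agree if they agree at one point. -/
theorem eqOn_of_horizontal {a b : ℝ} (hab : a < b) {c c' : ℝ → P}
    (hc : ContMDiffOn 𝓘(ℝ, ℝ) 𝓘(ℝ, EP) ∞ c (Icc a b))
    (hc' : ContMDiffOn 𝓘(ℝ, ℝ) 𝓘(ℝ, EP) ∞ c' (Icc a b))
    (h : ∀ t ∈ Icc a b, A.pullback c (Icc a b) t 1 = 0)
    (h' : ∀ t ∈ Icc a b, A.pullback c' (Icc a b) t 1 = 0)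
    (hproj : ∀ t ∈ Icc a b, B.proj (c' t) = B.proj (c t)) {t₀ : ℝ} (ht₀ : t₀ ∈ Icc a b)
    (h₀ : c' t₀ = c t₀) : EqOn c' c (Icc a b) := by
  have hk := B.contMDiffOn_div hc hc' hproj
  have hact : EqOn (fun t => B.act (c t) (B.div (c' t) (c t))) c' (Icc a b) :=
    fun t ht => B.act_div (hproj t ht)
  have hconst : ∀ t ∈ Icc a b, B.div (c' t) (c t) = 1 := by
    intro t ht
    rw [A.eq_of_pullback_eq_zero hab (k := fun t => B.div (c' t) (c t))
      (hc.mdifferentiableOn (by simp)) (hk.mdifferentiableOn (by simp)) h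
      (fun t ht => by rw [A.pullback_congr hact ht]; exact h' t ht) ht ht₀]
    simp only [h₀, B.div_self]
  intro t ht
  rw [← B.act_div (hproj t ht), hconst t ht, B.act_one]

end Connection

end PullbackForm

/-! ### Local existence of horizontal surfaces -/

section LocalLift

open scoped Topology

/-- Nondegenerate intervals are needed for unique derivatives. Truncation at 0 and 1 keeps them
nondegenerate even when `t₀` is an end point, where they are one-sided neighbourhoods. -/
theorem exists_Icc_subset_of_mem_nhdsWithin {t₀ : ℝ} (ht₀ : t₀ ∈ Icc (0 : ℝ) 1) {V : Set ℝ}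
    (hV : V ∈ 𝓝[Icc 0 1] t₀) :
    ∃ a b : ℝ, a < b ∧ Icc a b ⊆ Icc 0 1 ∧ Icc a b ⊆ V ∧ Icc a b ∈ 𝓝[Icc 0 1] t₀ := by
  obtain ⟨ε, hε, h⟩ := Metric.mem_nhdsWithin_iff.1 hV
  have hlt : max 0 (t₀ - ε / 2) < min 1 (t₀ + ε / 2) :=
    max_lt (lt_min one_pos (by linarith [ht₀.1])) (lt_min (by linarith [ht₀.2]) (by linarith))
  have hsub : Icc (max 0 (t₀ - ε / 2)) (min 1 (t₀ + ε / 2)) ⊆ Icc 0 1 :=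
    Icc_subset_Icc (le_max_left _ _) (min_le_left _ _)
  refine ⟨max 0 (t₀ - ε / 2), min 1 (t₀ + ε / 2), hlt, hsub, fun t ht => h ⟨?_, hsub ht⟩,
    Metric.mem_nhdsWithin_iff.2 ⟨ε / 2, by positivity, fun t ht => ?_⟩⟩
  · rw [mem_ball, Real.dist_eq, abs_lt]
    have h1 := (le_max_right _ _).trans ht.1
    have h2 := ht.2.trans (min_le_right _ _)
    constructor <;> linarith
  · have h1 := ht.1
    rw [mem_ball, Real.dist_eq, abs_lt] at h1
    exact ⟨max_le ht.2.1 (by linarith), le_min ht.2.2 (by linarith)⟩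

variable {EM EP EG : Type*}
  [NormedAddCommGroup EM] [NormedSpace ℝ EM]
  [NormedAddCommGroup EP] [NormedSpace ℝ EP]
  [NormedAddCommGroup EG] [NormedSpace ℝ EG] [FiniteDimensional ℝ EG]
  {M : Type*} [TopologicalSpace M] [ChartedSpace EM M]
  {P : Type*} [TopologicalSpace P] [ChartedSpace EP P]
  {G : Type*} [TopologicalSpace G] [ChartedSpace EG G] [Group G]
  [IsManifold 𝓘(ℝ, EP) ∞ P] {B : PrincipalBundle EM EP EG M P G} (A : Connection B)

namespace Connection

/-- If the connection form is invertible in the `y`-directions of `Ψ (z, y)`, then there is locally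
a function `y (z)` such that `Ψ (z, y (z))` is horizontal in the second coordinate of `z`. -/
theorem exists_horizontal_graph {a₁ b₁ c₁ d₁ r₁ : ℝ} (hab : a₁ < b₁) (hcd : c₁ < d₁) (hr : 0 < r₁)
    {s₀ t₀ : ℝ} {y₀ : EG}
    (hs₀ : s₀ ∈ Icc (0 : ℝ) 1) (ht₀ : t₀ ∈ Icc (0 : ℝ) 1)
    (hJn : Icc a₁ b₁ ∈ 𝓝[Icc 0 1] s₀) (hKn : Icc c₁ d₁ ∈ 𝓝[Icc 0 1] t₀)
    {Ψ : (ℝ × ℝ) × EG → P}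
    (hΨ : ContMDiffOn 𝓘(ℝ, (ℝ × ℝ) × EG) 𝓘(ℝ, EP) ∞ Ψ
      ((Icc a₁ b₁ ×ˢ Icc c₁ d₁) ×ˢ closedBall y₀ r₁))
    (hinv : ((A.modelForm (Ψ ((s₀, t₀), y₀))).comp ((modelDerivWithin ((ℝ × ℝ) × EG) EP Ψ
      ((Icc a₁ b₁ ×ˢ Icc c₁ d₁) ×ˢ closedBall y₀ r₁) ((s₀, t₀), y₀)).comp
        (ContinuousLinearMap.inr ℝ (ℝ × ℝ) EG))).IsInvertible) :
    ∃ a b c d : ℝ, a < b ∧ c < d ∧ Icc a b ⊆ Icc a₁ b₁ ∧ Icc c d ⊆ Icc c₁ d₁ ∧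
      Icc a b ∈ 𝓝[Icc 0 1] s₀ ∧ Icc c d ∈ 𝓝[Icc 0 1] t₀ ∧ ∃ y : ℝ × ℝ → EG,
      ContDiffOn ℝ ∞ y (Icc a b ×ˢ Icc c d) ∧ MapsTo y (Icc a b ×ˢ Icc c d) (closedBall y₀ r₁) ∧
      ∀ z ∈ Icc a b ×ˢ Icc c d,
        A.pullback (fun z => Ψ (z, y z)) (Icc a b ×ˢ Icc c d) z (0, 1) = 0 := by
  set D := (Icc a₁ b₁ ×ˢ Icc c₁ d₁) ×ˢ closedBall y₀ r₁ with hDdef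
  have hDu : UniqueDiffOn ℝ D :=
    (uniqueDiffOn_rectangle hab hcd).prod (uniqueDiffOn_convex (convex_closedBall y₀ r₁)
        ⟨y₀, ball_subset_interior_closedBall (mem_ball_self hr)⟩)
  let L : (ℝ × ℝ) × EG → EG →L[ℝ] EG := fun w =>
    (A.modelForm (Ψ w)).comp ((modelDerivWithin ((ℝ × ℝ) × EG) EP Ψ D w).comp
        (ContinuousLinearMap.inr ℝ (ℝ × ℝ) EG))
  have hLapp : ∀ w η, L w η = A.pullback Ψ D w (0, η) := fun w η => rfl
  have hL : ContDiffOn ℝ ∞ L D := contDiffOn_clm_apply.2 fun η => by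
    simp only [hLapp]
    exact A.contDiffOn_pullback hΨ hDu (0, η)
  have hw₀ : ((s₀, t₀), y₀) ∈ D :=
    ⟨⟨mem_of_mem_nhdsWithin hs₀ hJn, mem_of_mem_nhdsWithin ht₀ hKn⟩, mem_closedBall_self hr.le⟩
  -- Invertible operators form an open set, so invertibility at the base point persists nearby.
  have hLinv : {w | (L w).IsInvertible} ∈ 𝓝[D] ((s₀, t₀), y₀) := by
    obtain ⟨e, he⟩ := hinv
    have h := ContinuousLinearEquiv.nhds e
    rw [show (e : EG →L[ℝ] EG) = L ((s₀, t₀), y₀) from he] at h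
    exact (hL.continuousOn _ hw₀) h
  obtain ⟨u, hu, v, hv, huv⟩ := mem_nhdsWithin_prod_iff.1 hLinv
  obtain ⟨us, hus, ut, hut, hust⟩ := mem_nhdsWithin_prod_iff.1 hu
  obtain ⟨a, b, hab', -, habs, habn⟩ := exists_Icc_subset_of_mem_nhdsWithin hs₀
    (Filter.inter_mem hJn (nhdsWithin_le_of_mem hJn hus))
  obtain ⟨c₂, d₂, hcd₂, -, hcds₂, hcdn₂⟩ := exists_Icc_subset_of_mem_nhdsWithin ht₀
    (Filter.inter_mem hKn (nhdsWithin_le_of_mem hKn hut))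
  rw [nhdsWithin_eq_nhds.2 (closedBall_mem_nhds y₀ hr)] at hv
  obtain ⟨r₂, hr₂, hrv⟩ := Metric.nhds_basis_closedBall.mem_iff.1 hv
  set r := min r₁ r₂ with hrdef
  have hr0 : 0 < r := lt_min hr hr₂
  have hrr : closedBall y₀ r ⊆ closedBall y₀ r₁ := closedBall_subset_closedBall (min_le_left _ _)
  have hsubD : (Icc a b ×ˢ Icc c₂ d₂) ×ˢ closedBall y₀ r ⊆ D := fun w hw =>
    ⟨⟨(habs hw.1.1).1, (hcds₂ hw.1.2).1⟩, hrr hw.2⟩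
  have hsubL : ∀ w ∈ (Icc a b ×ˢ Icc c₂ d₂) ×ˢ closedBall y₀ r, (L w).IsInvertible := fun w hw =>
    huv ⟨hust ⟨(habs hw.1.1).2, (hcds₂ hw.1.2).2⟩,
      hrv (closedBall_subset_closedBall (min_le_right _ _) hw.2)⟩
  -- Horizontality of `t ↦ Ψ ((s, t), y)` reads `Ψ^*A(∂t) + L y' = 0`; this is that equation solved
  -- for `y'`.
  let f : (ℝ × ℝ) × EG → EG := fun w => -((L w).inverse (A.pullback Ψ D w ((0, 1), 0)))
  have hf : ContDiffOn ℝ ∞ f ((Icc a b ×ˢ Icc c₂ d₂) ×ˢ closedBall y₀ r) := by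
    refine ContDiffOn.neg (ContDiffOn.clm_apply (fun w hw => ?_)
      ((A.contDiffOn_pullback hΨ hDu ((0, 1), 0)).mono hsubD))
    exact (hsubL w hw).contDiffAt_map_inverse.comp_contDiffWithinAt w
      ((hL w (hsubD hw)).mono hsubD)
  obtain ⟨ε, hε, hsol⟩ := exists_isParametricSolution hab' hcd₂ hr0 hf
  -- Staying within `ε / 2` of `t₀` keeps the length of `[c, d]` below the existence time `ε`.
  obtain ⟨c, d, hcd', -, hcds, hcdn⟩ := exists_Icc_subset_of_mem_nhdsWithin ht₀
    (Filter.inter_mem hcdn₂ (mem_nhdsWithin_of_mem_nhds (ball_mem_nhds t₀ (half_pos hε))))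
  have hc := hcds (left_mem_Icc.2 hcd'.le)
  have hd := hcds (right_mem_Icc.2 hcd'.le)
  obtain ⟨y, hy⟩ := hsol c d hc.1 hd.1 hcd' (by
    have h1 := hc.2
    have h2 := hd.2
    rw [mem_ball, Real.dist_eq, abs_lt] at h1 h2
    linarith)
  have hKsub : Icc c d ⊆ Icc c₂ d₂ := fun t ht => (hcds ht).1
  have hsub' : (Icc a b ×ˢ Icc c d) ×ˢ closedBall y₀ r ⊆
      (Icc a b ×ˢ Icc c₂ d₂) ×ˢ closedBall y₀ r := fun w hw => ⟨⟨hw.1.1, hKsub hw.1.2⟩, hw.2⟩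
  have hysm := contDiffOn_of_isParametricSolution hy hab' hcd' (convex_closedBall y₀ r)
    (isCompact_closedBall y₀ r) ⟨y₀, ball_subset_interior_closedBall (mem_ball_self hr0)⟩
    (hf.mono hsub')
  refine ⟨a, b, c, d, hab', hcd', fun s hs => (habs hs).1, fun t ht => (hcds₂ (hKsub ht)).1,
    habn, hcdn, y, hysm, fun z hz => hrr (hy.mapsTo hz), ?_⟩
  rintro ⟨s, t⟩ hz
  set R := Icc a b ×ˢ Icc c d with hR
  have hRu : UniqueDiffOn ℝ R := uniqueDiffOn_rectangle hab' hcd'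
  have hyd : DifferentiableWithinAt ℝ y R (s, t) := hysm.differentiableOn (by simp) _ hz
  have hyder : fderivWithin ℝ y R (s, t) (0, 1) = f ((s, t), y (s, t)) := by
    have h1 : HasDerivWithinAt (fun t => (s, t)) ((0, 1) : ℝ × ℝ) (Icc c d) t :=
      (hasDerivWithinAt_const t (Icc c d) s).prodMk (hasDerivWithinAt_id t (Icc c d))
    have h2 := hyd.hasFDerivWithinAt.comp_hasDerivWithinAt t h1 fun t' ht' => ⟨hz.1, ht'⟩
    exact (uniqueDiffOn_Icc hcd' t hz.2).eq_deriv _ h2 (hy.hasDerivWithinAt s hz.1 t hz.2)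
  have hgder : fderivWithin ℝ (fun z => (z, y z)) R (s, t) (0, 1) =
      ((0, 1), f ((s, t), y (s, t))) := by
    have h := ((hasFDerivWithinAt_id (s, t) R).prodMk hyd.hasFDerivWithinAt).fderivWithin (hRu _ hz)
    simp only [id] at h
    rw [h, ContinuousLinearMap.prod_apply, hyder]
    rfl
  have hmaps : MapsTo (fun z => (z, y z)) R D := fun z hz => hsubD (hsub' ⟨hz, hy.mapsTo hz⟩)
  have hcomp := A.pullback_comp (f := Ψ) (g := fun z => (z, y z)) (S := D) (T := R) (z := (s, t))
    (hΨ.mdifferentiableOn (by simp) _ (hmaps hz)) (differentiableWithinAt_id.prodMk hyd) hmaps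
    (hRu _ hz) (0, 1)
  refine hcomp.trans ?_
  rw [hgder]
  have hsplit : (((0, 1), f ((s, t), y (s, t))) : (ℝ × ℝ) × EG) =
      ((0, 1), 0) + (0, f ((s, t), y (s, t))) := by simp
  rw [hsplit, A.pullback_add, ← hLapp]
  have hi := hsubL ((s, t), y (s, t)) (hsub' ⟨hz, hy.mapsTo hz⟩)
  simp only [f, map_neg]
  rw [hi.self_apply_inverse, add_neg_cancel]

/-- `Λ` lifts `Γ` on `J × K` and is horizontal in the second coordinate. -/
structure IsHorizontalSurface (Γ : ℝ × ℝ → M) (J K : Set ℝ) (Λ : ℝ × ℝ → P) : Prop where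
  contMDiffOn : ContMDiffOn 𝓘(ℝ, ℝ × ℝ) 𝓘(ℝ, EP) ∞ Λ (J ×ˢ K)
  proj : ∀ z ∈ J ×ˢ K, B.proj (Λ z) = Γ z
  horizontal : ∀ z ∈ J ×ˢ K, A.pullback Λ (J ×ˢ K) z (0, 1) = 0

variable [LieGroup 𝓘(ℝ, EG) ∞ G]

theorem exists_local_horizontalSurface {Γ : ℝ × ℝ → M}
    (hΓ : ContMDiffOn 𝓘(ℝ, ℝ × ℝ) 𝓘(ℝ, EM) ∞ Γ (Icc 0 1 ×ˢ Icc 0 1)) {s₀ t₀ : ℝ}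
    (hs₀ : s₀ ∈ Icc (0 : ℝ) 1) (ht₀ : t₀ ∈ Icc (0 : ℝ) 1) :
    ∃ a b c d : ℝ, a < b ∧ c < d ∧ Icc a b ⊆ Icc 0 1 ∧ Icc c d ⊆ Icc 0 1 ∧
      Icc a b ∈ 𝓝[Icc 0 1] s₀ ∧ Icc c d ∈ 𝓝[Icc 0 1] t₀ ∧
      ∃ Λ, A.IsHorizontalSurface Γ (Icc a b) (Icc c d) Λ := by
  have : IsManifold 𝓘(ℝ, EG) ∞ G := LieGroup.toContMDiffMul.toIsManifold
  have : IsManifold 𝓘(ℝ, EG) 1 G := IsManifold.of_le (n := ∞) (by simp)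
  have hz₀ : (s₀, t₀) ∈ Icc (0 : ℝ) 1 ×ˢ Icc (0 : ℝ) 1 := ⟨hs₀, ht₀⟩
  obtain ⟨U, e, hU, hx, hsrc, htgt, -, hsymm, hproj, -⟩ := B.locallyTrivial (Γ (s₀, t₀))
  let φ := extChartAt 𝓘(ℝ, EG) (1 : G)
  let y₀ := φ 1
  have hφ : φ.target ∈ 𝓝 y₀ := extChartAt_target_mem_nhds (I := 𝓘(ℝ, EG)) (1 : G)
  obtain ⟨r₁, hr₁, hrt⟩ := Metric.nhds_basis_closedBall.mem_iff.1 hφ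
  have hpre : Γ ⁻¹' U ∈ 𝓝[Icc 0 1 ×ˢ Icc 0 1] (s₀, t₀) :=
    (hΓ _ hz₀).continuousWithinAt (hU.mem_nhds hx)
  obtain ⟨us, hus, ut, hut, hust⟩ := mem_nhdsWithin_prod_iff.1 hpre
  obtain ⟨a₁, b₁, hab, hJ, hJs, hJn⟩ := exists_Icc_subset_of_mem_nhdsWithin hs₀ hus
  obtain ⟨c₁, d₁, hcd, hK, hKs, hKn⟩ := exists_Icc_subset_of_mem_nhdsWithin ht₀ hut
  have hRU : MapsTo Γ (Icc a₁ b₁ ×ˢ Icc c₁ d₁) U := fun z hz => hust ⟨hJs hz.1, hKs hz.2⟩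
  have hRS : Icc a₁ b₁ ×ˢ Icc c₁ d₁ ⊆ Icc 0 1 ×ˢ Icc 0 1 := prod_mono hJ hK
  set D := (Icc a₁ b₁ ×ˢ Icc c₁ d₁) ×ˢ closedBall y₀ r₁ with hD
  -- `σ` is the lift of `Γ` through the unit section of the trivialization; `Ψ` below moves it by
  -- the group element with coordinate `y`.
  let σ : ℝ × ℝ → P := fun z => e.symm (Γ z, 1)
  have hσ : ContMDiffOn 𝓘(ℝ, ℝ × ℝ) 𝓘(ℝ, EP) ∞ σ (Icc a₁ b₁ ×ˢ Icc c₁ d₁) :=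
    hsymm.comp ((hΓ.mono hRS).prodMk contMDiffOn_const) fun z hz => by
      rw [mem_preimage, htgt]; exact ⟨hRU hz, mem_univ _⟩
  have hσp : ∀ z ∈ Icc a₁ b₁ ×ˢ Icc c₁ d₁, B.proj (σ z) = Γ z := fun z hz => by
    have ht : (Γ z, (1 : G)) ∈ e.target := by rw [htgt]; exact ⟨hRU hz, mem_univ _⟩
    rw [← hproj _ (e.map_target ht), e.right_inv ht]
  have hφs : ContMDiffOn 𝓘(ℝ, EG) 𝓘(ℝ, EG) ∞ φ.symm φ.target := contMDiffOn_extChartAt_symm _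
  let Ψ : (ℝ × ℝ) × EG → P := fun w => B.act (σ w.1) (φ.symm w.2)
  have hΨ : ContMDiffOn 𝓘(ℝ, (ℝ × ℝ) × EG) 𝓘(ℝ, EP) ∞ Ψ D := by
    refine B.contMDiffOn_act (hσ.comp (t := Icc a₁ b₁ ×ˢ Icc c₁ d₁)
        (contDiff_fst.contMDiff.contMDiffOn) fun w hw => hw.1)
      (hφs.comp (t := φ.target) (contDiff_snd.contMDiff.contMDiffOn) fun w hw => hrt hw.2)
  have hbu : UniqueDiffOn ℝ (closedBall y₀ r₁) := uniqueDiffOn_convex (convex_closedBall y₀ r₁)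
        ⟨y₀, ball_subset_interior_closedBall (mem_ball_self hr₁)⟩
  have hy₀ : y₀ ∈ closedBall y₀ r₁ := mem_closedBall_self hr₁.le
  have hw₀ : ((s₀, t₀), y₀) ∈ D :=
    ⟨⟨mem_of_mem_nhdsWithin hs₀ hJn, mem_of_mem_nhdsWithin ht₀ hKn⟩, hy₀⟩
  have hone : φ.symm y₀ = 1 := extChartAt_to_inv (I := 𝓘(ℝ, EG)) (1 : G)
  have hφd : MDifferentiableAt 𝓘(ℝ, EG) 𝓘(ℝ, EG) φ.symm y₀ :=
    (hφs.contMDiffAt hφ).mdifferentiableAt (by simp)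
  -- At the unit, `A` reproduces generators of the action, so in the `y`-directions it reduces to
  -- the differential of the inverse chart of `G`, an isomorphism.
  have hinv : ((A.modelForm (Ψ ((s₀, t₀), y₀))).comp ((modelDerivWithin ((ℝ × ℝ) × EG) EP Ψ
      D ((s₀, t₀), y₀)).comp (ContinuousLinearMap.inr ℝ (ℝ × ℝ) EG))) =
      modelDeriv EG EG φ.symm y₀ := by
    ext η
    have h1 := A.pullback_comp (f := Ψ) (g := fun y => ((s₀, t₀), y)) (S := D)
      (T := closedBall y₀ r₁) (z := y₀) (hΨ.mdifferentiableOn (by simp) _ hw₀)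
      ((differentiableWithinAt_const _).prodMk differentiableWithinAt_id)
      (fun y hy => ⟨hw₀.1, hy⟩) (hbu _ hy₀) η
    have h2 : fderivWithin ℝ (fun y => ((s₀, t₀), y)) (closedBall y₀ r₁) y₀ η = (0, η) := by
      have h := ((hasFDerivWithinAt_const (s₀, t₀) y₀ (closedBall y₀ r₁)).prodMk
        (hasFDerivWithinAt_id y₀ _)).fderivWithin (hbu _ hy₀)
      simp only [id] at h
      rw [h]
      rfl
    rw [h2] at h1
    refine h1.symm.trans ?_
    change A.modelForm (Ψ ((s₀, t₀), y₀)) (modelDerivWithin EG EP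
      ((fun g => B.act (σ (s₀, t₀)) g) ∘ φ.symm) (closedBall y₀ r₁) y₀ η) = _
    rw [modelDeriv_comp_modelDerivWithin (B.mdifferentiable_act_right _ 1)
      hφd.mdifferentiableWithinAt (hbu _ hy₀).uniqueMDiffWithinAt hone]
    have h3 : Ψ ((s₀, t₀), y₀) = σ (s₀, t₀) := by
      simp only [Ψ, hone, B.act_one]
    rw [h3, A.modelForm_vertical]
    unfold modelDerivWithin modelDeriv
    rw [mfderivWithin_of_mem_nhds (closedBall_mem_nhds y₀ hr₁)]
  obtain ⟨a, b, c, d, hab', hcd', hJ', hK', hJn', hKn', y, hy, hym, hhor⟩ :=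
    A.exists_horizontal_graph hab hcd hr₁ hs₀ ht₀ hJn hKn hΨ (by
      rw [hinv]
      have h := isInvertible_mfderivWithin_extChartAt_symm (I := 𝓘(ℝ, EG)) (x := (1 : G))
        (y := y₀) (mem_extChartAt_target (I := 𝓘(ℝ, EG)) (1 : G))
      rw [modelWithCornersSelf_coe, range_id, mfderivWithin_univ] at h
      exact h)
  have hRR : Icc a b ×ˢ Icc c d ⊆ Icc a₁ b₁ ×ˢ Icc c₁ d₁ := prod_mono hJ' hK'
  refine ⟨a, b, c, d, hab', hcd', hJ'.trans hJ, hK'.trans hK, hJn', hKn', fun z => Ψ (z, y z),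
    ?_, fun z hz => ?_, hhor⟩
  · exact hΨ.comp (contDiffOn_id.prodMk hy).contMDiffOn fun z hz => ⟨hRR hz, hym hz⟩
  · simp only [Ψ, B.proj_act]
    exact hσp z (hRR hz)

end Connection

end LocalLift

/-! ### Gluing local horizontal surfaces into the lifted surface -/

section Gluing

open scoped Topology

variable {EM EP EG : Type*}
  [NormedAddCommGroup EM] [NormedSpace ℝ EM]
  [NormedAddCommGroup EP] [NormedSpace ℝ EP]
  [NormedAddCommGroup EG] [NormedSpace ℝ EG]
  {M : Type*} [TopologicalSpace M] [ChartedSpace EM M]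
  {P : Type*} [TopologicalSpace P] [ChartedSpace EP P]
  {G : Type*} [TopologicalSpace G] [ChartedSpace EG G] [Group G]
  [IsManifold 𝓘(ℝ, EP) ∞ P] {B : PrincipalBundle EM EP EG M P G} {A : Connection B}

namespace Connection

theorem pullback_congr_of_eventuallyEq {X : Type*} [NormedAddCommGroup X] [NormedSpace ℝ X]
    {f g : X → P} {S T : Set X} {z : X} (hz : z ∈ S) (hfg : f =ᶠ[𝓝[S] z] g) (hT : T ∈ 𝓝[S] z)
    (hg : MDifferentiableWithinAt 𝓘(ℝ, X) 𝓘(ℝ, EP) g T z) (hS : UniqueDiffWithinAt ℝ S z) (v : X) :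
    A.pullback f S z v = A.pullback g T z v := by
  have h1 : modelDerivWithin X EP f S z = modelDerivWithin X EP g S z :=
    hfg.mfderivWithin_eq_of_mem hz
  have h2 : modelDerivWithin X EP g S z = modelDerivWithin X EP g T z :=
    hg.mfderivWithin_mono_of_mem_nhdsWithin hS.uniqueMDiffWithinAt hT
  rw [pullback, pullback, h1, h2, hfg.eq_of_nhdsWithin hz]

namespace IsHorizontalSurface

variable {Γ : ℝ × ℝ → M} {J K : Set ℝ} {Λ Λ' : ℝ × ℝ → P}

theorem of_locally (hJK : UniqueDiffOn ℝ (J ×ˢ K))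
    (h : ∀ z ∈ J ×ˢ K, ∃ J' K' Λ', A.IsHorizontalSurface Γ J' K' Λ' ∧ J' ×ˢ K' ∈ 𝓝[J ×ˢ K] z ∧
      Λ =ᶠ[𝓝[J ×ˢ K] z] Λ') : A.IsHorizontalSurface Γ J K Λ := by
  refine ⟨fun z hz => ?_, fun z hz => ?_, fun z hz => ?_⟩ <;>
    obtain ⟨J', K', Λ', hΛ', hn, heq⟩ := h z hz
  · exact ((hΛ'.contMDiffOn z (mem_of_mem_nhdsWithin hz hn)).mono_of_mem_nhdsWithin
      hn).congr_of_eventuallyEq heq (heq.eq_of_nhdsWithin hz)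
  · rw [heq.eq_of_nhdsWithin hz]
    exact hΛ'.proj z (mem_of_mem_nhdsWithin hz hn)
  · have hz' := mem_of_mem_nhdsWithin hz hn
    rw [A.pullback_congr_of_eventuallyEq hz heq hn
      (hΛ'.contMDiffOn.mdifferentiableOn (by simp) z hz') (hJK z hz)]
    exact hΛ'.horizontal z hz'

theorem mono (hΛ : A.IsHorizontalSurface Γ J K Λ) {a b c d : ℝ} (hab : a < b) (hcd : c < d)
    (hJ : Icc a b ⊆ J) (hK : Icc c d ⊆ K) : A.IsHorizontalSurface Γ (Icc a b) (Icc c d) Λ := by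
  have hsub := prod_mono hJ hK
  refine ⟨hΛ.contMDiffOn.mono hsub, fun z hz => hΛ.proj z (hsub hz), fun z hz => ?_⟩
  rw [A.pullback_subset hsub (uniqueDiffOn_rectangle hab hcd z hz)
    (hΛ.contMDiffOn.mdifferentiableOn (by simp) z (hsub hz))]
  exact hΛ.horizontal z (hsub hz)

theorem contMDiffOn_slice (hΛ : A.IsHorizontalSurface Γ J K Λ) {s : ℝ} (hs : s ∈ J) :
    ContMDiffOn 𝓘(ℝ, ℝ) 𝓘(ℝ, EP) ∞ (fun t => Λ (s, t)) K :=
  hΛ.contMDiffOn.comp (contDiff_prodMk_right s).contMDiff.contMDiffOn fun _ ht => ⟨hs, ht⟩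

theorem contMDiffOn_slice_left (hΛ : A.IsHorizontalSurface Γ J K Λ) {t : ℝ} (ht : t ∈ K) :
    ContMDiffOn 𝓘(ℝ, ℝ) 𝓘(ℝ, EP) ∞ (fun s => Λ (s, t)) J :=
  hΛ.contMDiffOn.comp (contDiff_prodMk_left t).contMDiff.contMDiffOn fun _ hs => ⟨hs, ht⟩

/-- Affine paths in the second coordinate are horizontal. -/
theorem pullback_slice_mul (hΛ : A.IsHorizontalSurface Γ J K Λ) {s r t : ℝ} {K' : Set ℝ}
    (hs : s ∈ J) (ht : t ∈ K') (hK' : UniqueDiffOn ℝ K') (hr : ∀ τ ∈ K', r * τ ∈ K) :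
    A.pullback (fun τ => Λ (s, r * τ)) K' t 1 = 0 := by
  have hder : HasDerivWithinAt (fun τ : ℝ => (s, r * τ)) (0, r) K' t := by
    have h := (hasDerivWithinAt_const t K' s).prodMk ((hasDerivWithinAt_id t K').const_mul r)
    simpa using h
  have h := A.pullback_comp (f := Λ) (g := fun τ => (s, r * τ)) (S := J ×ˢ K) (T := K') (z := t)
    (hΛ.contMDiffOn.mdifferentiableOn (by simp) _ ⟨hs, hr t ht⟩) hder.differentiableWithinAt
    (fun τ hτ => ⟨hs, hr τ hτ⟩) (hK' t ht) 1
  refine h.trans ?_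
  have hd : fderivWithin ℝ (fun τ : ℝ => (s, r * τ)) K' t 1 = r • (0, 1) := by
    have := hder.derivWithin (hK' t ht)
    rw [derivWithin] at this
    rw [this]
    simp
  rw [hd, A.pullback_smul, hΛ.horizontal _ ⟨hs, hr t ht⟩, smul_zero]

theorem pullback_slice (hΛ : A.IsHorizontalSurface Γ J K Λ) {s t : ℝ} (hs : s ∈ J) (ht : t ∈ K)
    (hK : UniqueDiffOn ℝ K) : A.pullback (fun t => Λ (s, t)) K t 1 = 0 := by
  simpa only [one_mul] using hΛ.pullback_slice_mul (r := 1) hs ht hK (fun τ hτ => by rwa [one_mul])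

variable [LieGroup 𝓘(ℝ, EG) ∞ G]

/-- Since `k` depends on the first coordinate only, its t-derivative is 0, and the product rule
leaves `Ad` of 0. -/
theorem act (hΛ : A.IsHorizontalSurface Γ J K Λ) (hJ : UniqueDiffOn ℝ J) (hK : UniqueDiffOn ℝ K)
    {k : ℝ → G} (hk : ContMDiffOn 𝓘(ℝ, ℝ) 𝓘(ℝ, EG) ∞ k J) :
    A.IsHorizontalSurface Γ J K (fun z => B.act (Λ z) (k z.1)) := by
  have hk' : ContMDiffOn 𝓘(ℝ, ℝ × ℝ) 𝓘(ℝ, EG) ∞ (fun z : ℝ × ℝ => k z.1) (J ×ˢ K) :=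
    hk.comp contDiff_fst.contMDiff.contMDiffOn fun z hz => hz.1
  refine ⟨B.contMDiffOn_act hΛ.contMDiffOn hk', fun z hz => ?_, fun z hz => ?_⟩
  · rw [B.proj_act, hΛ.proj z hz]
  · rw [A.pullback_act (hΛ.contMDiffOn.mdifferentiableOn (by simp) z hz)
      (hk'.mdifferentiableOn (by simp) z hz) (hJ.prod hK z hz), hΛ.horizontal z hz, Ad_zero, zero_add]
    have h := modelDerivWithin_comp (f := Prod.fst) (g := k) (S := J ×ˢ K) (T := J) (x := z)
      (hk.mdifferentiableOn (by simp) z.1 hz.1)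
      (differentiableWithinAt_fst (𝕜 := ℝ)).mdifferentiableWithinAt
      (fun z hz => hz.1) (hJ.prod hK z hz).uniqueMDiffWithinAt rfl (0, 1)
    have h2 : modelDerivWithin (ℝ × ℝ) ℝ Prod.fst (J ×ˢ K) z (0, 1) = 0 := by
      rw [modelDerivWithin_eq_fderivWithin, fderivWithin_fst (hJ.prod hK z hz)]
      rfl
    rw [h2, map_zero] at h
    refine (congrArg (leftLog (k z.1)) h).trans (leftLog_zero _)

theorem eqOn {a b : ℝ} (hab : a < b) (hΛ : A.IsHorizontalSurface Γ J (Icc a b) Λ)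
    (hΛ' : A.IsHorizontalSurface Γ J (Icc a b) Λ') {t : ℝ} (ht : t ∈ Icc a b)
    (h : ∀ s ∈ J, Λ' (s, t) = Λ (s, t)) : EqOn Λ' Λ (J ×ˢ Icc a b) := by
  rintro ⟨s, τ⟩ ⟨hs, hτ⟩
  have hu := uniqueDiffOn_Icc hab
  exact A.eqOn_of_horizontal hab (hΛ.contMDiffOn_slice hs) (hΛ'.contMDiffOn_slice hs)
    (fun t ht => hΛ.pullback_slice hs ht hu) (fun t ht => hΛ'.pullback_slice hs ht hu)
    (fun t ht => (hΛ'.proj (s, t) ⟨hs, ht⟩).trans (hΛ.proj (s, t) ⟨hs, ht⟩).symm) ht (h s hs) hτ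

/-- The values of a horizontal surface over one parameter value can be prescribed. -/
theorem exists_init (hΛ : A.IsHorizontalSurface Γ J K Λ) (hJ : UniqueDiffOn ℝ J)
    (hK : UniqueDiffOn ℝ K) {t : ℝ} (ht : t ∈ K) {p : ℝ → P}
    (hp : ContMDiffOn 𝓘(ℝ, ℝ) 𝓘(ℝ, EP) ∞ p J) (hpp : ∀ s ∈ J, B.proj (p s) = Γ (s, t)) :
    ∃ Λ', A.IsHorizontalSurface Γ J K Λ' ∧ ∀ s ∈ J, Λ' (s, t) = p s := by
  have hproj : ∀ s ∈ J, B.proj (p s) = B.proj (Λ (s, t)) := fun s hs =>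
    (hpp s hs).trans (hΛ.proj _ ⟨hs, ht⟩).symm
  exact ⟨_, hΛ.act hJ hK (B.contMDiffOn_div (hΛ.contMDiffOn_slice_left ht) hp hproj),
    fun s hs => B.act_div (hproj s hs)⟩

/-- The surfaces agree at `t = c`, hence on the whole overlap `[c, T]` by uniqueness of horizontal
curves. As the overlap has positive length, the piecewise surface equals one of the two pieces near
every point, so it is smooth across the seam. -/
theorem exists_glue {a b T c d : ℝ} (hab : a < b) (hc : 0 ≤ c) (hcT : c < T) (hTd : T ≤ d)
    (hΛ : A.IsHorizontalSurface Γ (Icc a b) (Icc 0 T) Λ)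
    (hΛ' : A.IsHorizontalSurface Γ (Icc a b) (Icc c d) Λ')
    (h : ∀ s ∈ Icc a b, Λ' (s, c) = Λ (s, c)) :
    ∃ Λ'', A.IsHorizontalSurface Γ (Icc a b) (Icc 0 d) Λ'' ∧
      ∀ s ∈ Icc a b, Λ'' (s, 0) = Λ (s, 0) := by
  have hT0 : 0 < T := hc.trans_lt hcT
  have hov : EqOn Λ' Λ (Icc a b ×ˢ Icc c T) :=
    eqOn hcT (hΛ.mono hab hcT subset_rfl (Icc_subset_Icc_left hc))
      (hΛ'.mono hab hcT subset_rfl (Icc_subset_Icc_right hTd)) (left_mem_Icc.2 hcT.le) h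
  refine ⟨fun z => if z.2 ≤ T then Λ z else Λ' z, of_locally
    (uniqueDiffOn_rectangle hab (hT0.trans_le hTd)) fun z hz => ?_, fun s _ => if_pos hT0.le⟩
  by_cases hzT : z.2 < T
  · have hn : {w : ℝ × ℝ | w.2 < T} ∈ 𝓝 z := (isOpen_lt continuous_snd continuous_const).mem_nhds hzT
    refine ⟨_, _, Λ, hΛ, ?_, ?_⟩
    · filter_upwards [self_mem_nhdsWithin, mem_nhdsWithin_of_mem_nhds hn] with w hw hwT
      exact ⟨hw.1, hw.2.1, hwT.le⟩
    · filter_upwards [mem_nhdsWithin_of_mem_nhds hn] with w hwT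
      exact if_pos hwT.le
  · have hn : {w : ℝ × ℝ | c < w.2} ∈ 𝓝 z :=
      (isOpen_lt continuous_const continuous_snd).mem_nhds (hcT.trans_le (not_lt.1 hzT))
    refine ⟨_, _, Λ', hΛ', ?_, ?_⟩
    · filter_upwards [self_mem_nhdsWithin, mem_nhdsWithin_of_mem_nhds hn] with w hw hwc
      exact ⟨hw.1, hwc.le, hw.2.2⟩
    · filter_upwards [self_mem_nhdsWithin, mem_nhdsWithin_of_mem_nhds hn] with w hw hwc
      by_cases hwT : w.2 ≤ T
      · rw [if_pos hwT, hov ⟨hw.1, hwc.le, hwT⟩]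
      · rw [if_neg hwT]

end IsHorizontalSurface

variable (A) [LieGroup 𝓘(ℝ, EG) ∞ G]

/-- A bigon lifts to a smooth surface on a strip `J × [0, 1]` around each parameter value. -/
theorem exists_horizontalSurface_strip [FiniteDimensional ℝ EG] {Γ : ℝ × ℝ → M} {x y : M}
    (hΓ : IsBigon EM Γ x y) {p : P} (hp : B.proj p = x) {s₀ : ℝ} (hs₀ : s₀ ∈ Icc (0 : ℝ) 1) :
    ∃ a b : ℝ, a < b ∧ Icc a b ⊆ Icc 0 1 ∧ Icc a b ∈ 𝓝[Icc 0 1] s₀ ∧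
      ∃ Λ, A.IsHorizontalSurface Γ (Icc a b) (Icc 0 1) Λ ∧ ∀ s ∈ Icc a b, Λ (s, 0) = p := by
  have hloc := fun t : Icc (0 : ℝ) 1 => A.exists_local_horizontalSurface hΓ.contMDiffOn hs₀ t.2
  choose a b c d hab hcd hJ hK hJn hKn Λ hΛ using hloc
  choose O hO hOt hOK using fun t : Icc (0 : ℝ) 1 => mem_nhdsWithin.1 (hKn t)
  -- A Lebesgue number of the cover by local t-intervals allows a march in steps of `δ / 2`. The
  -- parameter interval shrinks at each step, but only finitely many steps are needed.
  obtain ⟨δ, hδ, hball⟩ := lebesgue_number_lemma_of_metric isCompact_Icc hO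
    (fun t ht => mem_iUnion.2 ⟨⟨t, ht⟩, hOt ⟨t, ht⟩⟩ : Icc (0 : ℝ) 1 ⊆ _)
  have key : ∀ n : ℕ, ∃ a b : ℝ, a < b ∧ Icc a b ⊆ Icc 0 1 ∧ Icc a b ∈ 𝓝[Icc 0 1] s₀ ∧
      ∃ Λ, A.IsHorizontalSurface Γ (Icc a b) (Icc 0 (min 1 ((n + 1) * (δ / 2)))) Λ ∧
        ∀ s ∈ Icc a b, Λ (s, 0) = p := by
    intro n
    induction n with
    | zero =>
      obtain ⟨i, hi⟩ := hball 0 ⟨le_rfl, zero_le_one⟩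
      have hT : (0 : ℝ) < min 1 (((0 : ℕ) + 1) * (δ / 2)) := lt_min one_pos (by positivity)
      have hsub : Icc 0 (min 1 (((0 : ℕ) + 1) * (δ / 2))) ⊆ Icc (c i) (d i) := fun t ht => by
        have h1 := ht.2.trans (min_le_left _ _)
        have h2 := ht.2.trans (min_le_right _ _)
        refine hOK i ⟨hi ?_, ht.1, h1⟩
        rw [Nat.cast_zero, zero_add, one_mul] at h2
        rw [mem_ball, Real.dist_eq, abs_lt]
        constructor <;> linarith [ht.1]
      obtain ⟨Λ', hΛ', h0⟩ := ((hΛ i).mono (hab i) hT subset_rfl hsub).exists_init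
        (uniqueDiffOn_Icc (hab i)) (uniqueDiffOn_Icc hT) (left_mem_Icc.2 hT.le)
        (p := fun _ => p) contMDiffOn_const
        (fun s hs => hp.trans (hΓ.source s (hJ i hs)).symm)
      exact ⟨a i, b i, hab i, hJ i, hJn i, Λ', hΛ', h0⟩
    | succ n ih =>
      obtain ⟨a₁, b₁, hab₁, hJ₁, hJn₁, Λ₁, hΛ₁, h₁⟩ := ih
      set T := min 1 (((n : ℕ) + 1) * (δ / 2)) with hT
      set T' := min 1 (((n + 1 : ℕ) + 1) * (δ / 2)) with hT'
      by_cases hT1 : 1 ≤ ((n : ℕ) + 1) * (δ / 2)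
      · have e1 : T = 1 := min_eq_left hT1
        have e2 : T' = 1 := min_eq_left (hT1.trans (by push_cast; gcongr; linarith))
        rw [e1] at hΛ₁
        rw [e2]
        exact ⟨a₁, b₁, hab₁, hJ₁, hJn₁, Λ₁, hΛ₁, h₁⟩
      · have e1 : T = ((n : ℕ) + 1) * (δ / 2) := min_eq_right (not_le.1 hT1).le
        have hTδ : δ / 2 ≤ T := by
          rw [e1]
          exact le_mul_of_one_le_left (by positivity) (by linarith [n.cast_nonneg (α := ℝ)])
        have hT1' : T ≤ 1 := min_le_left _ _
        have hTT' : T ≤ T' := le_min hT1' (by rw [e1]; push_cast; gcongr; linarith)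
        have hT'T : T' ≤ T + δ / 2 := (min_le_right _ _).trans (by rw [e1]; push_cast; linarith)
        obtain ⟨i, hi⟩ := hball T ⟨by linarith, hT1'⟩
        -- The new piece starts `δ / 4` before `T` to create the overlap for gluing, and still lies
        -- in the `δ`-ball around `T`.
        have hsub : Icc (T - δ / 4) T' ⊆ Icc (c i) (d i) := fun t ht => by
          refine hOK i ⟨hi ?_, by linarith [ht.1], ht.2.trans (min_le_left _ _)⟩
          rw [mem_ball, Real.dist_eq, abs_lt]
          constructor <;> linarith [ht.1, ht.2]
        obtain ⟨a₂, b₂, hab₂, hJ₂, hJs₂, hJn₂⟩ := exists_Icc_subset_of_mem_nhdsWithin hs₀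
          (Filter.inter_mem hJn₁ (hJn i))
        have hlt : T - δ / 4 < T' := by linarith
        have hT0 : 0 < T := by linarith
        have hΛ₁' := hΛ₁.mono hab₂ hT0 (fun s hs => (hJs₂ hs).1) subset_rfl
        have hmem : T - δ / 4 ∈ Icc 0 T := ⟨by linarith, by linarith⟩
        obtain ⟨Λ₂, hΛ₂, h₂⟩ := ((hΛ i).mono hab₂ hlt (fun s hs => (hJs₂ hs).2) hsub).exists_init
          (uniqueDiffOn_Icc hab₂) (uniqueDiffOn_Icc hlt) (left_mem_Icc.2 hlt.le)
          (hΛ₁'.contMDiffOn_slice_left hmem) (fun s hs => hΛ₁'.proj _ ⟨hs, hmem⟩)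
        obtain ⟨Λ₃, hΛ₃, h₃⟩ := IsHorizontalSurface.exists_glue hab₂ hmem.1 (by linarith) hTT' hΛ₁'
          hΛ₂ h₂
        exact ⟨a₂, b₂, hab₂, hJ₂, hJn₂, Λ₃, hΛ₃,
          fun s hs => (h₃ s hs).trans (h₁ s (hJs₂ hs).1)⟩
  obtain ⟨n, hn⟩ := exists_nat_ge (1 / (δ / 2))
  obtain ⟨a, b, hab, hJ, hJn, Λ, hΛ, h⟩ := key n
  have : min 1 (((n : ℕ) + 1) * (δ / 2)) = 1 := min_eq_left (by
    rw [div_le_iff₀ (by positivity)] at hn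
    linarith)
  rw [this] at hΛ
  exact ⟨a, b, hab, hJ, hJn, Λ, hΛ, h⟩

variable {A}

theorem IsHorizontalLift.eqOn {γ : ℝ → M} {p : P} {c c' : ℝ → P} (hc : A.IsHorizontalLift γ p c)
    (hc' : A.IsHorizontalLift γ p c') : EqOn c' c (Icc 0 1) :=
  A.eqOn_of_horizontal zero_lt_one hc.contMDiffOn hc'.contMDiffOn hc.horizontal hc'.horizontal
    (fun t ht => (hc'.proj t ht).trans (hc.proj t ht).symm) (left_mem_Icc.2 zero_le_one)
    (hc'.init.trans hc.init.symm)

theorem IsHorizontalLift.tra_eq {γ : ℝ → M} {p : P} {c : ℝ → P} (hc : A.IsHorizontalLift γ p c) :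
    A.tra γ p = c 1 := by
  have h : ∃ c, A.IsHorizontalLift γ p c := ⟨c, hc⟩
  rw [tra, dif_pos h]
  exact hc.eqOn h.choose_spec (right_mem_Icc.2 zero_le_one)

/-- Rescaling a horizontal curve keeps it horizontal, so `τ ↦ Λ (s, t τ)` is the lift defining the
transport, with end point `Λ (s, t)`. The case `t = 0` is included. -/
theorem IsHorizontalSurface.liftedSurface_eq {Γ : ℝ × ℝ → M} {J : Set ℝ} {Λ : ℝ × ℝ → P} {p : P}
    (hΛ : A.IsHorizontalSurface Γ J (Icc 0 1) Λ) (h0 : ∀ s ∈ J, Λ (s, 0) = p) :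
    EqOn (A.liftedSurface Γ p) Λ (J ×ˢ Icc 0 1) := by
  rintro ⟨s, t⟩ ⟨hs, ht⟩
  have hmul : ∀ τ ∈ Icc (0 : ℝ) 1, t * τ ∈ Icc (0 : ℝ) 1 := fun τ hτ =>
    ⟨mul_nonneg ht.1 hτ.1, mul_le_one₀ ht.2 hτ.1 hτ.2⟩
  have hlift : A.IsHorizontalLift (fun τ => Γ (s, t * τ)) p (fun τ => Λ (s, t * τ)) := by
    refine ⟨(hΛ.contMDiffOn_slice hs).comp (contDiff_const.mul contDiff_id).contMDiff.contMDiffOn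
      hmul, by simpa using h0 s hs, fun τ hτ => hΛ.proj _ ⟨hs, hmul τ hτ⟩, fun τ hτ => ?_⟩
    exact hΛ.pullback_slice_mul hs hτ (uniqueDiffOn_Icc zero_lt_one) hmul
  rw [liftedSurface, hlift.tra_eq, mul_one]

variable (A)

/-- Strips over different parameter intervals need no matching: each of them equals the globally
defined surface, which inherits smoothness and horizontality locally. -/
theorem isHorizontalSurface_liftedSurface [FiniteDimensional ℝ EG] {Γ : ℝ × ℝ → M} {x y : M}
    (hΓ : IsBigon EM Γ x y) {p : P} (hp : B.proj p = x) :
    A.IsHorizontalSurface Γ (Icc 0 1) (Icc 0 1) (A.liftedSurface Γ p) ∧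
      ∀ s ∈ Icc (0 : ℝ) 1, A.liftedSurface Γ p (s, 0) = p := by
  constructor
  · refine IsHorizontalSurface.of_locally (uniqueDiffOn_rectangle zero_lt_one zero_lt_one)
      fun z hz => ?_
    obtain ⟨a, b, -, -, hJn, Λ, hΛ, h0⟩ := A.exists_horizontalSurface_strip hΓ hp hz.1
    have hn : Icc a b ×ˢ Icc 0 1 ∈ 𝓝[Icc 0 1 ×ˢ Icc 0 1] z := nhdsWithin_prod hJn self_mem_nhdsWithin
    exact ⟨_, _, Λ, hΛ, hn, Filter.eventuallyEq_of_mem hn (hΛ.liftedSurface_eq h0)⟩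
  · intro s hs
    obtain ⟨a, b, -, -, hJn, Λ, hΛ, h0⟩ := A.exists_horizontalSurface_strip hΓ hp hs
    have hsJ := mem_of_mem_nhdsWithin hs hJn
    rw [hΛ.liftedSurface_eq h0 ⟨hsJ, left_mem_Icc.2 zero_le_one⟩, h0 s hsJ]

end Connection

end Gluing

/-- This removes the bracket term of the curvature, since `A(∂t) = 0` on a horizontal surface. -/
theorem bracket_zero_right {EG : Type*} [NormedAddCommGroup EG] [NormedSpace ℝ EG]
    [CompleteSpace EG] {G : Type*} [TopologicalSpace G] [ChartedSpace EG G] [Group G]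
    [LieGroup 𝓘(ℝ, EG) ∞ G] (ξ : EG) : bracket G ξ 0 = 0 := by
  have : LieGroup 𝓘(ℝ, EG) (minSmoothness ℝ 3) G := LieGroup.of_le (n := ∞) (by
    rw [minSmoothness_of_isRCLikeNormedField]
    exact ENat.LEInfty.out)
  unfold bracket
  exact lie_zero (L := GroupLieAlgebra 𝓘(ℝ, EG) G) (M := GroupLieAlgebra 𝓘(ℝ, EG) G) ξ

/-! ### Curvature of horizontal surfaces and the path ordered equation -/

section Stokes

open scoped Topology

variable {EM EP EG : Type*}
  [NormedAddCommGroup EM] [NormedSpace ℝ EM]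
  [NormedAddCommGroup EP] [NormedSpace ℝ EP]
  [NormedAddCommGroup EG] [NormedSpace ℝ EG]
  {M : Type*} [TopologicalSpace M] [ChartedSpace EM M]
  {P : Type*} [TopologicalSpace P] [ChartedSpace EP P]
  {G : Type*} [TopologicalSpace G] [ChartedSpace EG G] [Group G]
  [IsManifold 𝓘(ℝ, EP) ∞ P] {B : PrincipalBundle EM EP EG M P G} (A : Connection B)

namespace Connection

theorem chartForm_eq_pullback (q : P) {e : EP} (he : e ∈ (extChartAt 𝓘(ℝ, EP) q).target) (v : EP) :
    chartForm A.form q e v =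
      A.pullback (extChartAt 𝓘(ℝ, EP) q).symm (extChartAt 𝓘(ℝ, EP) q).target e v := by
  have h : modelDerivWithin EP EP (extChartAt 𝓘(ℝ, EP) q).symm (extChartAt 𝓘(ℝ, EP) q).target e =
      modelDeriv EP EP (extChartAt 𝓘(ℝ, EP) q).symm e :=
    mfderivWithin_of_mem_nhds ((isOpen_extChartAt_target q).mem_nhds he)
  rw [pullback, h]
  rfl

theorem contDiffOn_chartForm [FiniteDimensional ℝ EP] (q : P) :
    ContDiffOn ℝ ∞ (chartForm A.form q) (extChartAt 𝓘(ℝ, EP) q).target :=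
  contDiffOn_clm_apply.2 fun v =>
    (A.contDiffOn_pullback (contMDiffOn_extChartAt_symm q)
      (isOpen_extChartAt_target q).uniqueDiffOn v).congr fun _ he => A.chartForm_eq_pullback q he v

section Chart

variable {X : Type*} [NormedAddCommGroup X] [NormedSpace ℝ X]

theorem contDiffWithinAt_extChartAt_comp {f : X → P} {S : Set X} {z : X} {q : P}
    (hf : ContMDiffWithinAt 𝓘(ℝ, X) 𝓘(ℝ, EP) ∞ f S z)
    (hq : f z ∈ (extChartAt 𝓘(ℝ, EP) q).source) :
    ContDiffWithinAt ℝ ∞ (extChartAt 𝓘(ℝ, EP) q ∘ f) S z := by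
  rw [extChartAt_source] at hq
  exact ((contMDiffAt_extChartAt' hq).comp_contMDiffWithinAt z hf).contDiffWithinAt

theorem pullback_eq_chartForm {f : X → P} {S : Set X} {z : X} {q : P} (hz : z ∈ S)
    (hf : ContMDiffWithinAt 𝓘(ℝ, X) 𝓘(ℝ, EP) ∞ f S z) (hS : UniqueDiffWithinAt ℝ S z)
    (hq : f z ∈ (extChartAt 𝓘(ℝ, EP) q).source) (v : X) :
    A.pullback f S z v = chartForm A.form q (extChartAt 𝓘(ℝ, EP) q (f z))
      (fderivWithin ℝ (extChartAt 𝓘(ℝ, EP) q ∘ f) S z v) := by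
  set φ := extChartAt 𝓘(ℝ, EP) q with hφ
  have hu := (contDiffWithinAt_extChartAt_comp hf hq).differentiableWithinAt (by simp)
  have ht : φ (f z) ∈ φ.target := φ.map_source hq
  have hsymm : MDifferentiableAt 𝓘(ℝ, EP) 𝓘(ℝ, EP) φ.symm (φ (f z)) :=
    ((contMDiffOn_extChartAt_symm (n := ∞) q).contMDiffAt
      ((isOpen_extChartAt_target q).mem_nhds ht)).mdifferentiableAt (by simp)
  have heq : f =ᶠ[𝓝[S] z] φ.symm ∘ (φ ∘ f) := by
    filter_upwards [hf.continuousWithinAt ((isOpen_extChartAt_source q).mem_nhds hq)] with w hw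
    exact (φ.left_inv hw).symm
  have h1 : modelDerivWithin X EP f S z = modelDerivWithin X EP (φ.symm ∘ (φ ∘ f)) S z :=
    heq.mfderivWithin_eq_of_mem hz
  rw [pullback, h1, modelDeriv_comp_modelDerivWithin hsymm hu.mdifferentiableWithinAt
    hS.uniqueMDiffWithinAt rfl, modelDerivWithin_eq_fderivWithin]
  change _ = A.modelForm (φ.symm (φ (f z))) (modelDeriv EP EP φ.symm (φ (f z)) _)
  rw [φ.left_inv hq]

/-- The differential of `z ↦ (f^* A)_z v`, computed in the chart around `f z`. -/
theorem fderivWithin_pullback [FiniteDimensional ℝ EP] {f : X → P} {S : Set X} {z : X} (hz : z ∈ S)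
    (hf : ContMDiffOn 𝓘(ℝ, X) 𝓘(ℝ, EP) ∞ f S) (hS : UniqueDiffOn ℝ S) (v w : X) :
    fderivWithin ℝ (fun z => A.pullback f S z v) S z w =
      fderiv ℝ (chartForm A.form (f z)) (extChartAt 𝓘(ℝ, EP) (f z) (f z))
        (fderivWithin ℝ (extChartAt 𝓘(ℝ, EP) (f z) ∘ f) S z w)
        (fderivWithin ℝ (extChartAt 𝓘(ℝ, EP) (f z) ∘ f) S z v) +
      chartForm A.form (f z) (extChartAt 𝓘(ℝ, EP) (f z) (f z))
        (fderivWithin ℝ (fderivWithin ℝ (extChartAt 𝓘(ℝ, EP) (f z) ∘ f) S) S z w v) := by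
  set q := f z with hq
  set φ := extChartAt 𝓘(ℝ, EP) q with hφ
  have hqs : q ∈ φ.source := mem_extChartAt_source q
  have hu : ContDiffWithinAt ℝ ∞ (φ ∘ f) S z := contDiffWithinAt_extChartAt_comp (hf z hz) hqs
  have hα : DifferentiableAt ℝ (chartForm A.form q) (φ q) :=
    ((A.contDiffOn_chartForm q).contDiffAt ((isOpen_extChartAt_target q).mem_nhds
      (φ.map_source hqs))).differentiableAt (by simp)
  have hDu : DifferentiableWithinAt ℝ (fderivWithin ℝ (φ ∘ f) S) S z :=
    (hu.fderivWithin_right (m := ∞) hS (by simp) hz).differentiableWithinAt (by simp)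
  have hα' : HasFDerivAt (chartForm A.form q) (fderiv ℝ (chartForm A.form q) (φ q)) ((φ ∘ f) z) :=
    hα.hasFDerivAt
  have h1 := hα'.comp_hasFDerivWithinAt z
    (hu.differentiableWithinAt (by simp)).hasFDerivWithinAt
  have h2 := h1.clm_apply (hDu.hasFDerivWithinAt.clm_apply (hasFDerivWithinAt_const v z S))
  -- Near `z` the pull-back is the chart form along `φ ∘ f` applied to the derivative of `φ ∘ f`, so
  -- its differential follows from the product rule.
  have heq : (fun z => A.pullback f S z v) =ᶠ[𝓝[S] z]
      fun z => (chartForm A.form q ∘ (φ ∘ f)) z (fderivWithin ℝ (φ ∘ f) S z v) := by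
    filter_upwards [self_mem_nhdsWithin,
      (hf z hz).continuousWithinAt ((isOpen_extChartAt_source q).mem_nhds hqs)] with w hw hws
    exact A.pullback_eq_chartForm hw (hf w hw) (hS w hw) hws v
  rw [heq.fderivWithin_eq_of_mem hz, h2.fderivWithin (hS z hz)]
  simp [add_comm, ← hq]

end Chart

/-- The curvature of a horizontal surface is the derivative of the connection form. -/
theorem pullbackCurvature_eq [FiniteDimensional ℝ EP] [FiniteDimensional ℝ EG]
    [LieGroup 𝓘(ℝ, EG) ∞ G] {Γ : ℝ × ℝ → M} {Λ : ℝ × ℝ → P}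
    (hΛ : A.IsHorizontalSurface Γ (Icc 0 1) (Icc 0 1) Λ) {z : ℝ × ℝ}
    (hz : z ∈ Icc (0 : ℝ) 1 ×ˢ Icc (0 : ℝ) 1) :
    A.pullbackCurvature Λ z =
      -fderivWithin ℝ (fun z => A.pullback Λ (Icc 0 1 ×ˢ Icc 0 1) z (1, 0))
        (Icc 0 1 ×ˢ Icc 0 1) z (0, 1) := by
  set S := Icc (0 : ℝ) 1 ×ˢ Icc (0 : ℝ) 1 with hS
  have hSu : UniqueDiffOn ℝ S := uniqueDiffOn_rectangle zero_lt_one zero_lt_one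
  set φ := extChartAt 𝓘(ℝ, EP) (Λ z) with hφ
  have hqs : Λ z ∈ φ.source := mem_extChartAt_source (Λ z)
  have hu : ContDiffWithinAt ℝ ∞ (φ ∘ Λ) S z :=
    contDiffWithinAt_extChartAt_comp (hΛ.contMDiffOn z hz) hqs
  -- Points of the closed square lie in the closure of its interior, so second derivatives within it
  -- are symmetric even on the boundary.
  have hcl : z ∈ closure (interior S) := by
    rw [hS, interior_prod_eq, closure_prod_eq, interior_Icc, closure_Ioo zero_ne_one]
    exact hz
  have hsymm := hu.isSymmSndFDerivWithinAt (by
    rw [minSmoothness_of_isRCLikeNormedField]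
    exact ENat.LEInfty.out) hSu hcl hz
  -- `Λ^*A(∂t)` vanishes identically, hence so does its s-derivative. Expanded in the chart, this
  -- and the t-derivative of `Λ^*A(∂s)` share the same second derivative term, which cancels and
  -- leaves `dA`.
  have hhor : fderivWithin ℝ (fun z => A.pullback Λ S z (0, 1)) S z (1, 0) = 0 := by
    rw [fderivWithin_congr' (f := fun _ => (0 : EG)) hΛ.horizontal hz]
    simp
  rw [A.fderivWithin_pullback hz hΛ.contMDiffOn hSu] at hhor ⊢
  rw [hsymm.eq] at hhor
  have hd : ∀ v, modelDeriv EP EP φ (Λ z) (modelDerivWithin (ℝ × ℝ) EP Λ S z v) =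
      fderivWithin ℝ (φ ∘ Λ) S z v := fun v => by
    rw [← modelDerivWithin_eq_fderivWithin, modelDeriv_comp_modelDerivWithin (y := Λ z)
      (mdifferentiableAt_extChartAt (mem_chart_source EP (Λ z)))
      (hΛ.contMDiffOn.mdifferentiableOn (by simp) z hz) (hSu z hz).uniqueMDiffWithinAt rfl]
  have hh : A.form (Λ z) (mfderivWithin 𝓘(ℝ, ℝ × ℝ) 𝓘(ℝ, EP) Λ S z ((0, 1) : ℝ × ℝ)) = 0 :=
    hΛ.horizontal z hz
  rw [pullbackCurvature, curvature, ← hS, hh, bracket_zero_right, add_zero, extDerivForm]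
  change fderiv ℝ (chartForm A.form (Λ z)) (φ (Λ z))
        (modelDeriv EP EP φ (Λ z) (modelDerivWithin (ℝ × ℝ) EP Λ S z (1, 0)))
        (modelDeriv EP EP φ (Λ z) (modelDerivWithin (ℝ × ℝ) EP Λ S z (0, 1))) -
      fderiv ℝ (chartForm A.form (Λ z)) (φ (Λ z))
        (modelDeriv EP EP φ (Λ z) (modelDerivWithin (ℝ × ℝ) EP Λ S z (0, 1)))
        (modelDeriv EP EP φ (Λ z) (modelDerivWithin (ℝ × ℝ) EP Λ S z (1, 0))) = _
  rw [← hφ] at hhor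
  rw [hd, hd, ← hφ, eq_neg_of_add_eq_zero_right hhor]
  abel

variable [LieGroup 𝓘(ℝ, EG) ∞ G]

/-- If `c · g` is constant, where `(c^* A)(∂s) = -a`, then `g` solves `g' = a g`. -/
theorem isPathOrderedSolution_of_act_eq {c : ℝ → P} {g : ℝ → G} {a : ℝ → EG} {q : P}
    (hc : ContMDiffOn 𝓘(ℝ, ℝ) 𝓘(ℝ, EP) ∞ c (Icc 0 1))
    (hg : ContMDiffOn 𝓘(ℝ, ℝ) 𝓘(ℝ, EG) ∞ g (Icc 0 1))
    (ha : ∀ s ∈ Icc (0 : ℝ) 1, A.pullback c (Icc 0 1) s 1 = -a s)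
    (hq : ∀ s ∈ Icc (0 : ℝ) 1, B.act (c s) (g s) = q) (h0 : g 0 = 1) :
    IsPathOrderedSolution a g := by
  refine ⟨h0, hg.mdifferentiableOn (by simp), fun s hs => ?_⟩
  have h := A.pullback_act (hc.mdifferentiableOn (by simp) s hs)
    (hg.mdifferentiableOn (by simp) s hs) (uniqueDiffOn_Icc zero_lt_one s hs) 1
  -- The constant curve has zero pull-back, so `0 = -Ad_{g⁻¹} a + g⁻¹ g'`, and `Ad_{g⁻¹} a` is the
  -- left logarithm of the right translate of `a`.
  rw [A.pullback_congr (g := fun _ => q) hq hs, A.pullback_const, ha s hs, Ad_neg,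
    ← leftLog_rightTranslate] at h
  exact leftLog_injective (EG := EG) (g s) (eq_of_neg_add_eq_zero h.symm).symm

/-- Any solution makes `c · g` horizontal. Two such curves differ by `g⁻¹ g'`, which is therefore
constant, and equals 1 at 0. -/
theorem eqOn_of_isPathOrderedSolution {c : ℝ → P} {g g' : ℝ → G} {a : ℝ → EG}
    (hc : ContMDiffOn 𝓘(ℝ, ℝ) 𝓘(ℝ, EP) ∞ c (Icc 0 1))
    (ha : ∀ s ∈ Icc (0 : ℝ) 1, A.pullback c (Icc 0 1) s 1 = -a s)
    (hg : IsPathOrderedSolution a g) (hg' : IsPathOrderedSolution a g') :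
    EqOn g' g (Icc 0 1) := by
  have hcd := hc.mdifferentiableOn (n := ∞) (by simp)
  have hhor : ∀ g : ℝ → G, IsPathOrderedSolution a g → ∀ s ∈ Icc (0 : ℝ) 1,
      A.pullback (fun s => B.act (c s) (g s)) (Icc 0 1) s 1 = 0 := fun g hg s hs => by
    rw [A.pullback_act (hcd s hs) (hg.differentiable s hs) (uniqueDiffOn_Icc zero_lt_one s hs),
      ha s hs, Ad_neg]
    have : modelDerivWithin ℝ EG g (Icc 0 1) s 1 = rightTranslate (a s) (g s) := hg.deriv s hs
    rw [this, leftLog_rightTranslate, neg_add_cancel]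
  have hmul : ∀ s, B.act (B.act (c s) (g s)) ((g s)⁻¹ * g' s) = B.act (c s) (g' s) := fun s => by
    rw [← B.act_mul, mul_inv_cancel_left]
  have hk : ∀ s ∈ Icc (0 : ℝ) 1,
      MDifferentiableWithinAt 𝓘(ℝ, ℝ) 𝓘(ℝ, EG) (fun s => (g s)⁻¹ * g' s) (Icc 0 1) s := by
    intro s hs
    have hinv : MDifferentiableAt 𝓘(ℝ, EG) 𝓘(ℝ, EG) (fun x : G => x⁻¹) (g s) :=
      (contMDiff_inv 𝓘(ℝ, EG) ∞).mdifferentiable (by simp) _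
    have hm : MDifferentiableAt (𝓘(ℝ, EG).prod 𝓘(ℝ, EG)) 𝓘(ℝ, EG) (fun z : G × G => z.1 * z.2)
        ((g s)⁻¹, g' s) := (contMDiff_mul 𝓘(ℝ, EG) ∞).mdifferentiable (by simp) _
    exact hm.comp_mdifferentiableWithinAt s
      ((hinv.comp_mdifferentiableWithinAt s (hg.differentiable s hs)).prodMk
        (hg'.differentiable s hs))
  intro s hs
  have h := A.eq_of_pullback_eq_zero zero_lt_one (c := fun s => B.act (c s) (g s))
    (k := fun s => (g s)⁻¹ * g' s)
    (fun s hs => B.mdifferentiableWithinAt_act (hcd s hs) (hg.differentiable s hs)) hk (hhor g hg)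
    (fun s hs => by simpa only [hmul] using hhor g' hg' s hs) hs (left_mem_Icc.2 zero_le_one)
  simp only [hg.init, hg'.init, inv_one, mul_one] at h
  exact (inv_mul_eq_one.1 h).symm

end Connection

end Stokes

end NAStokes

/-! ### The non-Abelian Stokes theorem -/

theorem mainTheorem2
    {EM EP EG : Type*}
    [NormedAddCommGroup EM] [NormedSpace ℝ EM] [FiniteDimensional ℝ EM]
    [NormedAddCommGroup EP] [NormedSpace ℝ EP] [FiniteDimensional ℝ EP]
    [NormedAddCommGroup EG] [NormedSpace ℝ EG] [FiniteDimensional ℝ EG]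
    {M : Type*} [TopologicalSpace M] [T2Space M] [ChartedSpace EM M] [IsManifold 𝓘(ℝ, EM) ∞ M]
    {P : Type*} [TopologicalSpace P] [T2Space P] [ChartedSpace EP P] [IsManifold 𝓘(ℝ, EP) ∞ P]
    {G : Type*} [TopologicalSpace G] [ChartedSpace EG G] [Group G] [LieGroup 𝓘(ℝ, EG) ∞ G]
    (B : NAStokes.PrincipalBundle EM EP EG M P G) (A : NAStokes.Connection B)
    (x y : M) (Γ : ℝ × ℝ → M) (hΓ : NAStokes.IsBigon EM Γ x y)
    (p : P) (hp : B.proj p = x) :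
    -- the surface lifts each path `Γ_s` horizontally, and the pull-back of the curvature makes sense
    (∀ s ∈ Icc (0 : ℝ) 1,
      A.IsHorizontalLift (fun t => Γ (s, t)) p (fun t => A.liftedSurface Γ p (s, t))) ∧
    ContMDiffOn 𝓘(ℝ, ℝ × ℝ) 𝓘(ℝ, EP) 1 (A.liftedSurface Γ p) (Icc 0 1 ×ˢ Icc 0 1) ∧
    (∀ s ∈ Icc (0 : ℝ) 1,
      IntervalIntegrable (fun t => A.pullbackCurvature (A.liftedSurface Γ p) (s, t)) volume 0 1) ∧
    -- the path ordered exponential exists and equals the ratio of the parallel transports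
    (∃ g : ℝ → G, NAStokes.IsPathOrderedSolution (A.curvatureIntegral (A.liftedSurface Γ p)) g) ∧
    B.div (A.tra (fun t => Γ (0, t)) p) (A.tra (fun t => Γ (1, t)) p) =
      NAStokes.pathOrderedExp (A.curvatureIntegral (A.liftedSurface Γ p)) := by
  obtain ⟨hΛ, hinit⟩ := A.isHorizontalSurface_liftedSurface hΓ hp
  set Λ := A.liftedSurface Γ p with hΛdef
  set S := Icc (0 : ℝ) 1 ×ˢ Icc (0 : ℝ) 1 with hS
  have hSu : UniqueDiffOn ℝ S := NAStokes.uniqueDiffOn_rectangle zero_lt_one zero_lt_one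
  have hIu : UniqueDiffOn ℝ (Icc (0 : ℝ) 1) := uniqueDiffOn_Icc zero_lt_one
  have h0 : (0 : ℝ) ∈ Icc (0 : ℝ) 1 := left_mem_Icc.2 zero_le_one
  have h1 : (1 : ℝ) ∈ Icc (0 : ℝ) 1 := right_mem_Icc.2 zero_le_one
  let h : ℝ × ℝ → EG := fun z => A.pullback Λ S z (1, 0)
  have hh : ContDiffOn ℝ ∞ h S := A.contDiffOn_pullback hΛ.contMDiffOn hSu (1, 0)
  have hpt : ∀ t : ℝ, ContinuousOn (fun τ : ℝ => (t, τ)) (Icc 0 1) := fun t =>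
    (Continuous.prodMk_right t).continuousOn
  have hcont : ∀ s ∈ Icc (0 : ℝ) 1,
      ContinuousOn (fun t => A.pullbackCurvature Λ (s, t)) (Icc 0 1) := fun s hs => by
    refine ContinuousOn.congr (f := fun t => -fderivWithin ℝ h S (s, t) (0, 1)) ?_
      fun t ht => A.pullbackCurvature_eq hΛ ⟨hs, ht⟩
    exact (((hh.continuousOn_fderivWithin hSu (by simp)).comp (hpt s)
      fun t ht => ⟨hs, ht⟩).clm_apply continuousOn_const).neg
  have hint : ∀ s ∈ Icc (0 : ℝ) 1,
      IntervalIntegrable (fun t => A.pullbackCurvature Λ (s, t)) volume 0 1 := fun s hs =>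
    (hcont s hs).intervalIntegrable_of_Icc zero_le_one
  have hslice : ∀ s ∈ Icc (0 : ℝ) 1, ∀ t ∈ Icc (0 : ℝ) 1,
      A.pullback (fun s => Λ (s, t)) (Icc 0 1) s 1 = h (s, t) := fun s hs t ht => by
    have hder : HasDerivWithinAt (fun s : ℝ => (s, t)) (1, 0) (Icc 0 1) s :=
      (hasDerivWithinAt_id s _).prodMk (hasDerivWithinAt_const s _ t)
    have hc := A.pullback_comp (f := Λ) (g := fun s => (s, t)) (S := S) (T := Icc 0 1) (z := s)
      (hΛ.contMDiffOn.mdifferentiableOn (by simp) _ ⟨hs, ht⟩) hder.differentiableWithinAt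
      (fun s hs => ⟨hs, ht⟩) (hIu s hs) 1
    have hd := hder.derivWithin (hIu s hs)
    rw [derivWithin] at hd
    rw [hd] at hc
    exact hc
  -- The edge `t = 0` is the constant curve at `p`, so the integration in `t` has no boundary term
  -- there.
  have hh0 : ∀ s ∈ Icc (0 : ℝ) 1, h (s, 0) = 0 := fun s hs => by
    rw [← hslice s hs 0 h0, A.pullback_congr (g := fun _ => p) hinit hs, A.pullback_const]
  have hcurv : ∀ s ∈ Icc (0 : ℝ) 1, A.curvatureIntegral Λ s = -h (s, 1) := fun s hs => by
    have hder : ∀ t ∈ Ioo (0 : ℝ) 1,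
        HasDerivAt (fun t => -h (s, t)) (A.pullbackCurvature Λ (s, t)) t := fun t ht => by
      have ht' := Ioo_subset_Icc_self ht
      have hd : HasDerivWithinAt (fun t : ℝ => (s, t)) (0, 1) (Icc 0 1) t :=
        (hasDerivWithinAt_const t _ s).prodMk (hasDerivWithinAt_id t _)
      have hc := (hh.differentiableOn (by simp) (s, t) ⟨hs, ht'⟩).hasFDerivWithinAt
        |>.comp_hasDerivWithinAt t hd (fun τ hτ => ⟨hs, hτ⟩)
      rw [A.pullbackCurvature_eq hΛ ⟨hs, ht'⟩]
      exact (hc.hasDerivAt (Icc_mem_nhds ht.1 ht.2)).neg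
    rw [NAStokes.Connection.curvatureIntegral,
      intervalIntegral.integral_eq_sub_of_hasDerivAt_of_le (f := fun t => -h (s, t)) zero_le_one
        (hh.continuousOn.comp (hpt s) fun t ht => ⟨hs, ht⟩).neg hder (hint s hs), hh0 s hs]
    simp
  let q : ℝ → P := fun s => Λ (s, 1)
  have hq : ContMDiffOn 𝓘(ℝ, ℝ) 𝓘(ℝ, EP) ∞ q (Icc 0 1) := hΛ.contMDiffOn_slice_left h1
  -- The fixed end point `y` puts all `q s` in a single fibre, which makes the divisions `q 0 : q s`
  -- meaningful.
  have hqp : ∀ s ∈ Icc (0 : ℝ) 1, B.proj (q s) = y := fun s hs =>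
    (hΛ.proj _ ⟨hs, h1⟩).trans (hΓ.target s hs)
  have hqq : ∀ s ∈ Icc (0 : ℝ) 1, B.proj (q 0) = B.proj (q s) := fun s hs =>
    (hqp 0 h0).trans (hqp s hs).symm
  have hqa : ∀ s ∈ Icc (0 : ℝ) 1,
      A.pullback q (Icc 0 1) s 1 = -A.curvatureIntegral Λ s := fun s hs => by
    rw [hcurv s hs, neg_neg]
    exact hslice s hs 1 h1
  have hsol : NAStokes.IsPathOrderedSolution (A.curvatureIntegral Λ)
      (fun s => B.div (q 0) (q s)) :=
    A.isPathOrderedSolution_of_act_eq hq (B.contMDiffOn_div hq contMDiffOn_const hqq) hqa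
      (fun s hs => B.act_div (hqq s hs)) (B.div_self _)
  have htra : ∀ s, A.tra (fun t => Γ (s, t)) p = q s := fun s => by
    simp only [q, hΛdef, NAStokes.Connection.liftedSurface, one_mul]
  refine ⟨fun s hs => ⟨hΛ.contMDiffOn_slice hs, hinit s hs, fun t ht => hΛ.proj _ ⟨hs, ht⟩,
    fun t ht => hΛ.pullback_slice hs ht hIu⟩, hΛ.contMDiffOn.of_le (by simp), hint,
    ⟨_, hsol⟩, ?_⟩
  have hex : ∃ g : ℝ → G, NAStokes.IsPathOrderedSolution (A.curvatureIntegral Λ) g := ⟨_, hsol⟩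
  -- The chosen solution need not be the one constructed; uniqueness identifies their values at 1.
  rw [NAStokes.pathOrderedExp, dif_pos hex, htra, htra]
  exact (A.eqOn_of_isPathOrderedSolution hq hqa hsol hex.choose_spec h1).symm
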